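/- Consider the planar Newtonian four-body problem with masses $m_1=m_2=m_3=1$, $m_4=m$, total mass $M=3+m$, and mutual distances $r_{ij}$. Write $\mathbf x=(\lambda_0,\mu,r_{12},r_{13},r_{14},r_{23},r_{24},r_{34})\in\mathbb R^8$ and $$U=\sum_{i<j}\frac{m_im_j}{r_{ij}},\qquad I=\frac1M\sum_{i<j}m_im_jr_{ij}^2,\qquad S=\det\begin{bmatrix}0&1&1&1&1\\1&0&r_{12}^2&r_{13}^2&r_{14}^2\\1&r_{12}^2&0&r_{23}^2&r_{24}^2\\1&r_{13}^2&r_{23}^2&0&r_{34}^2\\1&r_{14}^2&r_{24}^2&r_{34}^2&0\end{bmatrix},\qquad V=U+\lambda_0(I-1)+\mu S.$$ Let $F(\cdot,m):\mathbb R^8\to\mathbb R^8$ be the Dziobek map obtained from the partial derivatives of $V$ by clearing denominators, $$F=\Bigl(M\,\tfrac{\partial V}{\partial\lambda_0},\ \tfrac{\partial V}{\partial\mu},\ M r_{ij}^2\,\tfrac{\partial V}{\partial r_{ij}}\ (1\le i<j\le 4)\Bigr)$$ (a polynomial map). $DF$ and $D^2F$ denote derivatives with respect to $\mathbf x$, and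 $F_m$ the derivative with respect to $m$. A decimal number followed by $?$ denotes the closed interval of numbers that differ from it by at most one unit in its last displayed digit, and $0.?\times10^{-9}$ denotes $[-10^{-9},10^{-9}]$. **Theorem.** In the box $$[\mathbf x^*]=\begin{bmatrix}4.10486749931246396567394557?\\0.7904883951465367?\\0.98742601345654?\\0.57921860462471?\\1.00549177029900?\\0.57921860462471?\\1.00549177029900?\\0.57304559793134?\end{bmatrix},\qquad [m^*]=1.00266054757261000068580350?$$ there is exactly one $(\mathbf x^*,m^*)\in[\mathbf x^*]\times[m^*]$ with $F(\mathbf x^*,m^*)=0$ and $\det DF(\mathbf x^*,m^*)=0$. Moreover: 1. $\mathbf x^*$ is $\mathbb Z_2$-symmetric, i.e. $r_{13}=r_{23}$ and $r_{14}=r_{24}$, and its last six entries are the mutual distances of a planar central configuration $(q_1,q_2,q_3,q_4)$ of the masses $(1,1,1,m^*)$ in which $q_3$ lies in the interior of the convex hull of $q_1,q_2,q_4$. (Central configuration: the $q_i$ are distinct and, for some $\lambda\in\mathbb R$, $\lambda(q_j-q_G)=\sum_{i\ne j}m_i(q_i-q_j)/r_{ij}^3$ for all $j$, where $q_G$ is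 the centre of mass.) 2. The kernel of $A=DF(\mathbf x^*,m^*)$ is one-dimensional, and there are $\mathbf v,\mathbf w$ with $A\mathbf v=0$, $A^T\mathbf w=0$ and $$\mathbf v\in\begin{bmatrix}0.?\times10^{-9}\\-0.179026448?\\2.989514215?\\-0.5496816801?\\-1.4331568126?\\-0.5496816801?\\-1.4331568126?\\1\end{bmatrix},\qquad \mathbf w\in\begin{bmatrix}0.?\times10^{-9}\\-0.235312131?\\1.0068617795?\\-0.5380276784?\\-0.46549501352?\\-0.5380276784?\\-0.46549501352?\\1\end{bmatrix},$$ $$\mathbf w^TF_m(\mathbf x^*,m^*)\in-6.501134640?,\qquad \mathbf w^T[D^2F(\mathbf x^*,m^*)(\mathbf v,\mathbf v)]\in-2066.64414?\,;$$ in particular both numbers are nonzero. 3. The equation $F(\mathbf x,m)=0$ has a fold (saddle-node) bifurcation at $(\mathbf x^*,m^*)$, with the solutions on the side $m<m^*$. That is: near $(\mathbf x^*,m^*)$ the zero set of $F$ is a smooth curve $s\mapsto(\gamma(s),\mu(s))$, $|s|<\delta$, with $\gamma$ injective, $\gamma(0)=\mathbf x^*$, $\mu(0)=m^*$, $\gamma'(0)\ne0$,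 $\mu'(0)=0$, $\mu''(0)<0$; and every neighbourhood of $\mathbf x^*$ contains a neighbourhood $\mathcal U$ of $\mathbf x^*$ for which there is $\varepsilon>0$ such that, in $\mathcal U$, the equation $F(\mathbf x,m)=0$ has exactly two solutions if $m^*-\varepsilon<m<m^*$, only the solution $\mathbf x^*$ if $m=m^*$, and no solution if $m^*<m<m^*+\varepsilon$. -/

import Mathlib

open scoped Topology ContDiff

noncomputable section

namespace FourBody

/-! Planar four-body problem with masses `m₁ = m₂ = m₃ = 1`, `m₄ = m`.
The eight unknowns are ordered as `x = (lam, mu, r₁₂, r₁₃, r₁₄, r₂₃, r₂₄, r₃₄)`. -/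

/-- The masses `(1, 1, 1, m)`. -/
def mass (m : ℝ) : Fin 4 → ℝ := ![1, 1, 1, m]

/-- The Newtonian potential `U = ∑_{i<j} mᵢ mⱼ / rᵢⱼ`. -/
def potential (x : Fin 8 → ℝ) (m : ℝ) : ℝ :=
  1 / x 2 + 1 / x 3 + m / x 4 + 1 / x 5 + m / x 6 + m / x 7

/-- `∑_{i<j} mᵢ mⱼ rᵢⱼ²`, which is the total mass `M = 3 + m` times the moment of inertia. -/
def weightedSquares (x : Fin 8 → ℝ) (m : ℝ) : ℝ :=
  x 2 ^ 2 + x 3 ^ 2 + m * x 4 ^ 2 + x 5 ^ 2 + m * x 6 ^ 2 + m * x 7 ^ 2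

/-- The moment of inertia `I = (1 / M) ∑_{i<j} mᵢ mⱼ rᵢⱼ²`. -/
def inertia (x : Fin 8 → ℝ) (m : ℝ) : ℝ := weightedSquares x m / (3 + m)

/-- The Cayley-Menger determinant `S` of the six mutual distances. -/
def cayleyMenger (x : Fin 8 → ℝ) : ℝ :=
  Matrix.det !![0, 1, 1, 1, 1;
                1, 0, x 2 ^ 2, x 3 ^ 2, x 4 ^ 2;
                1, x 2 ^ 2, 0, x 5 ^ 2, x 6 ^ 2;
                1, x 3 ^ 2, x 5 ^ 2, 0, x 7 ^ 2;
                1, x 4 ^ 2, x 6 ^ 2, x 7 ^ 2, 0]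

/-- Dziobek's function `V = U + lam (I - 1) + mu S`, with both multipliers among the variables. -/
def lagrangian (x : Fin 8 → ℝ) (m : ℝ) : ℝ :=
  potential x m + x 0 * (inertia x m - 1) + x 1 * cayleyMenger x

/-- `sPartial a b c d e f` is `(1 / 2) ∂S / ∂(r_ij²)`, where `a = r_ij²`, `f = r_kl²` is the
opposite edge, `b = r_ik²`, `c = r_il²`, `d = r_jk²`, `e = r_jl²`. -/
def sPartial (a b c d e f : ℝ) : ℝ := f * (b + c + d + e - 2 * a - f) - (b - c) * (d - e)

/-- The Dziobek map `F = (F₁, …, F₈)`: the eight partial derivatives of `lagrangian`, in the order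
of the variables, with the denominators cleared, i.e. multiplied by `M = 3 + m` (first component),
`1` (second component) and `M rᵢⱼ²` (the components belonging to `rᵢⱼ`);
see `dziobek_eq_clearing_mul_deriv`. -/
def dziobek (x : Fin 8 → ℝ) (m : ℝ) : Fin 8 → ℝ :=
  ![weightedSquares x m - (3 + m),
    cayleyMenger x,
    -(3 + m) + 2 * x 0 * x 2 ^ 3 + 4 * (3 + m) * x 1 * x 2 ^ 3 *
      sPartial (x 2 ^ 2) (x 3 ^ 2) (x 4 ^ 2) (x 5 ^ 2) (x 6 ^ 2) (x 7 ^ 2),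
    -(3 + m) + 2 * x 0 * x 3 ^ 3 + 4 * (3 + m) * x 1 * x 3 ^ 3 *
      sPartial (x 3 ^ 2) (x 2 ^ 2) (x 4 ^ 2) (x 5 ^ 2) (x 7 ^ 2) (x 6 ^ 2),
    -(3 + m) * m + 2 * x 0 * m * x 4 ^ 3 + 4 * (3 + m) * x 1 * x 4 ^ 3 *
      sPartial (x 4 ^ 2) (x 2 ^ 2) (x 3 ^ 2) (x 6 ^ 2) (x 7 ^ 2) (x 5 ^ 2),
    -(3 + m) + 2 * x 0 * x 5 ^ 3 + 4 * (3 + m) * x 1 * x 5 ^ 3 *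
      sPartial (x 5 ^ 2) (x 2 ^ 2) (x 6 ^ 2) (x 3 ^ 2) (x 7 ^ 2) (x 4 ^ 2),
    -(3 + m) * m + 2 * x 0 * m * x 6 ^ 3 + 4 * (3 + m) * x 1 * x 6 ^ 3 *
      sPartial (x 6 ^ 2) (x 2 ^ 2) (x 5 ^ 2) (x 4 ^ 2) (x 7 ^ 2) (x 3 ^ 2),
    -(3 + m) * m + 2 * x 0 * m * x 7 ^ 3 + 4 * (3 + m) * x 1 * x 7 ^ 3 *
      sPartial (x 7 ^ 2) (x 3 ^ 2) (x 5 ^ 2) (x 4 ^ 2) (x 6 ^ 2) (x 2 ^ 2)]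

/-- The factors that clear the denominators of the partial derivatives of `lagrangian`. -/
def clearing (x : Fin 8 → ℝ) (m : ℝ) : Fin 8 → ℝ :=
  ![3 + m, 1, (3 + m) * x 2 ^ 2, (3 + m) * x 3 ^ 2, (3 + m) * x 4 ^ 2,
    (3 + m) * x 5 ^ 2, (3 + m) * x 6 ^ 2, (3 + m) * x 7 ^ 2]

theorem cayleyMenger_eq (x : Fin 8 → ℝ) :
    cayleyMenger x =
      2 * (x 2 ^ 2 * x 7 ^ 2 * (x 3 ^ 2 + x 4 ^ 2 + x 5 ^ 2 + x 6 ^ 2 - x 2 ^ 2 - x 7 ^ 2)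
        + x 3 ^ 2 * x 6 ^ 2 * (x 2 ^ 2 + x 4 ^ 2 + x 5 ^ 2 + x 7 ^ 2 - x 3 ^ 2 - x 6 ^ 2)
        + x 4 ^ 2 * x 5 ^ 2 * (x 2 ^ 2 + x 3 ^ 2 + x 6 ^ 2 + x 7 ^ 2 - x 4 ^ 2 - x 5 ^ 2)
        - x 2 ^ 2 * x 3 ^ 2 * x 5 ^ 2 - x 2 ^ 2 * x 4 ^ 2 * x 6 ^ 2
        - x 3 ^ 2 * x 4 ^ 2 * x 7 ^ 2 - x 5 ^ 2 * x 6 ^ 2 * x 7 ^ 2) := by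
  unfold cayleyMenger
  simp [Matrix.det_succ_row_zero, Fin.sum_univ_succ, Fin.succAbove]
  ring

theorem deriv_aux (c₀ c₁ c₂ c₃ t : ℝ) (ht : t ≠ 0) :
    deriv (fun t => c₀ + c₁ / t + c₂ * t ^ 2 + c₃ * t ^ 4) t =
      -c₁ / t ^ 2 + 2 * c₂ * t + 4 * c₃ * t ^ 3 := by
  have h := ((((hasDerivAt_id t).inv ht).const_mul c₁).const_add c₀).add
    (((hasDerivAt_pow 2 t).const_mul c₂).add ((hasDerivAt_pow 4 t).const_mul c₃))
  convert h.deriv using 1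
  · congr 1
    funext s
    simp [div_eq_mul_inv]
    ring
  · simp
    ring

theorem dziobek_eq_clearing_mul_deriv (x : Fin 8 → ℝ) (m : ℝ) (hm : 3 + m ≠ 0)
    (hx : ∀ k, 2 ≤ k → x k ≠ 0) (k : Fin 8) :
    dziobek x m k =
      clearing x m k * deriv (fun t => lagrangian (Function.update x k t) m) (x k) := by
  have key : ∀ (k : Fin 8) (c₁ c₂ c₃ : ℝ), 2 ≤ k →
      (∀ t, lagrangian (Function.update x k t) m =
        lagrangian (Function.update x k 0) m + c₁ / t + c₂ * t ^ 2 + c₃ * t ^ 4) →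
      deriv (fun t => lagrangian (Function.update x k t) m) (x k) =
        -c₁ / x k ^ 2 + 2 * c₂ * x k + 4 * c₃ * x k ^ 3 := by
    intro k c₁ c₂ c₃ hk h
    rw [funext h]
    exact deriv_aux _ _ _ _ _ (hx k hk)
  fin_cases k
  · have h : (fun t => lagrangian (Function.update x 0 t) m) =
        fun t => potential x m + t * (inertia x m - 1) + x 1 * cayleyMenger x := by
      funext t
      simp [lagrangian, potential, inertia, weightedSquares, cayleyMenger]
    simp only [Fin.mk_zero, h]
    simp [dziobek, clearing, inertia]
    field_simp
  · have h : (fun t => lagrangian (Function.update x 1 t) m) =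
        fun t => potential x m + x 0 * (inertia x m - 1) + t * cayleyMenger x := by
      funext t
      simp [lagrangian, potential, inertia, weightedSquares, cayleyMenger]
    simp only [Fin.mk_one, h]
    simp [dziobek, clearing]
  · have hk := hx 2 (by decide)
    have h := key 2 1 (x 0 * 1 / (3 + m) + 2 * x 1 * sPartial 0 (x 3 ^ 2) (x 4 ^ 2) (x 5 ^ 2) (x 6 ^ 2) (x 7 ^ 2))
      (-2 * x 1 * x 7 ^ 2) (by decide) (by
        intro t
        simp [lagrangian, potential, inertia, weightedSquares, cayleyMenger_eq, sPartial]
        ring)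
    simp only [Fin.reduceFinMk, h]
    simp [dziobek, clearing, sPartial]
    field_simp
    ring
  · have hk := hx 3 (by decide)
    have h := key 3 1 (x 0 * 1 / (3 + m) + 2 * x 1 * sPartial 0 (x 2 ^ 2) (x 4 ^ 2) (x 5 ^ 2) (x 7 ^ 2) (x 6 ^ 2))
      (-2 * x 1 * x 6 ^ 2) (by decide) (by
        intro t
        simp [lagrangian, potential, inertia, weightedSquares, cayleyMenger_eq, sPartial]
        ring)
    simp only [Fin.reduceFinMk, h]
    simp [dziobek, clearing, sPartial]
    field_simp
    ring
  · have hk := hx 4 (by decide)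
    have h := key 4 m (x 0 * m / (3 + m) + 2 * x 1 * sPartial 0 (x 2 ^ 2) (x 3 ^ 2) (x 6 ^ 2) (x 7 ^ 2) (x 5 ^ 2))
      (-2 * x 1 * x 5 ^ 2) (by decide) (by
        intro t
        simp [lagrangian, potential, inertia, weightedSquares, cayleyMenger_eq, sPartial]
        ring)
    simp only [Fin.reduceFinMk, h]
    simp [dziobek, clearing, sPartial]
    field_simp
    ring
  · have hk := hx 5 (by decide)
    have h := key 5 1 (x 0 * 1 / (3 + m) + 2 * x 1 * sPartial 0 (x 2 ^ 2) (x 6 ^ 2) (x 3 ^ 2) (x 7 ^ 2) (x 4 ^ 2))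
      (-2 * x 1 * x 4 ^ 2) (by decide) (by
        intro t
        simp [lagrangian, potential, inertia, weightedSquares, cayleyMenger_eq, sPartial]
        ring)
    simp only [Fin.reduceFinMk, h]
    simp [dziobek, clearing, sPartial]
    field_simp
    ring
  · have hk := hx 6 (by decide)
    have h := key 6 m (x 0 * m / (3 + m) + 2 * x 1 * sPartial 0 (x 2 ^ 2) (x 5 ^ 2) (x 4 ^ 2) (x 7 ^ 2) (x 3 ^ 2))
      (-2 * x 1 * x 3 ^ 2) (by decide) (by
        intro t
        simp [lagrangian, potential, inertia, weightedSquares, cayleyMenger_eq, sPartial]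
        ring)
    simp only [Fin.reduceFinMk, h]
    simp [dziobek, clearing, sPartial]
    field_simp
    ring
  · have hk := hx 7 (by decide)
    have h := key 7 m (x 0 * m / (3 + m) + 2 * x 1 * sPartial 0 (x 3 ^ 2) (x 5 ^ 2) (x 4 ^ 2) (x 6 ^ 2) (x 2 ^ 2))
      (-2 * x 1 * x 2 ^ 2) (by decide) (by
        intro t
        simp [lagrangian, potential, inertia, weightedSquares, cayleyMenger_eq, sPartial]
        ring)
    simp only [Fin.reduceFinMk, h]
    simp [dziobek, clearing, sPartial]
    field_simp
    ring

/-- The Jacobian matrix `DF` of `F(·, m)` at `x`. -/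
def jacobian (F : (Fin 8 → ℝ) → ℝ → Fin 8 → ℝ) (x : Fin 8 → ℝ) (m : ℝ) :
    Matrix (Fin 8) (Fin 8) ℝ :=
  LinearMap.toMatrix' (fderiv ℝ (fun y => F y m) x : (Fin 8 → ℝ) →ₗ[ℝ] Fin 8 → ℝ)

/-- The closed interval with centre `c` and radius `10 ^ (-k)`. -/
def decimalInterval (c : ℝ) (k : ℕ) : Set ℝ := Set.Icc (c - 1 / 10 ^ k) (c + 1 / 10 ^ k)

/-- The box of the variables `(lam, mu, r₁₂, r₁₃, r₁₄, r₂₃, r₂₄, r₃₄)`. -/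
def xBox : Set (Fin 8 → ℝ) :=
  {x | x 0 ∈ decimalInterval 4.10486749931246396567394557 26 ∧
    x 1 ∈ decimalInterval 0.7904883951465367 16 ∧
    x 2 ∈ decimalInterval 0.98742601345654 14 ∧
    x 3 ∈ decimalInterval 0.57921860462471 14 ∧
    x 4 ∈ decimalInterval 1.00549177029900 14 ∧
    x 5 ∈ decimalInterval 0.57921860462471 14 ∧
    x 6 ∈ decimalInterval 1.00549177029900 14 ∧
    x 7 ∈ decimalInterval 0.57304559793134 14}

/-- The interval of the mass parameter. -/
def mBox : Set ℝ := decimalInterval 1.00266054757261000068580350 26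

/-- Enclosure of the right null vector, normalized to have last component `1`. -/
def vBox : Set (Fin 8 → ℝ) :=
  {v | v 0 ∈ decimalInterval 0 9 ∧
    v 1 ∈ decimalInterval (-0.179026448) 9 ∧
    v 2 ∈ decimalInterval 2.989514215 9 ∧
    v 3 ∈ decimalInterval (-0.5496816801) 10 ∧
    v 4 ∈ decimalInterval (-1.4331568126) 10 ∧
    v 5 ∈ decimalInterval (-0.5496816801) 10 ∧
    v 6 ∈ decimalInterval (-1.4331568126) 10 ∧
    v 7 = 1}

/-- Enclosure of the left null vector, normalized to have last component `1`. -/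
def wBox : Set (Fin 8 → ℝ) :=
  {w | w 0 ∈ decimalInterval 0 9 ∧
    w 1 ∈ decimalInterval (-0.235312131) 9 ∧
    w 2 ∈ decimalInterval 1.0068617795 10 ∧
    w 3 ∈ decimalInterval (-0.5380276784) 10 ∧
    w 4 ∈ decimalInterval (-0.46549501352) 11 ∧
    w 5 ∈ decimalInterval (-0.5380276784) 10 ∧
    w 6 ∈ decimalInterval (-0.46549501352) 11 ∧
    w 7 = 1}

/-- The action on `ℝ⁸` of the exchange of the bodies `1` and `2`:
`(lam, mu, r₁₂, r₁₃, r₁₄, r₂₃, r₂₄, r₃₄) ↦ (lam, mu, r₁₂, r₂₃, r₂₄, r₁₃, r₁₄, r₃₄)`. -/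
def swap12 (x : Fin 8 → ℝ) : Fin 8 → ℝ := ![x 0, x 1, x 2, x 5, x 6, x 3, x 4, x 7]

/-- The last six entries of `x` are the mutual distances of the points `q`. -/
def HasMutualDistances (q : Fin 4 → EuclideanSpace ℝ (Fin 2)) (x : Fin 8 → ℝ) : Prop :=
  dist (q 0) (q 1) = x 2 ∧ dist (q 0) (q 2) = x 3 ∧ dist (q 0) (q 3) = x 4 ∧
    dist (q 1) (q 2) = x 5 ∧ dist (q 1) (q 3) = x 6 ∧ dist (q 2) (q 3) = x 7

/-- The centre of mass. -/
def centerOfMass {n d : ℕ} (μ : Fin n → ℝ) (q : Fin n → EuclideanSpace ℝ (Fin d)) :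
    EuclideanSpace ℝ (Fin d) :=
  (∑ i, μ i)⁻¹ • ∑ i, μ i • q i

/-- Central configurations of `n` distinct points with masses `μ`:
`lam (q_j - q_G) = ∑_{i ≠ j} m_i (q_i - q_j) / r_ij³` for all `j`, with one constant `lam`. -/
def IsCentralConfiguration {n d : ℕ} (μ : Fin n → ℝ) (q : Fin n → EuclideanSpace ℝ (Fin d)) :
    Prop :=
  Function.Injective q ∧ ∃ lam : ℝ, ∀ j, lam • (q j - centerOfMass μ q) =
    ∑ i ∈ Finset.univ.erase j, (μ i / dist (q i) (q j) ^ 3) • (q i - q j)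

/-- The one-parameter family of equations `F(x, μ) = 0` has a fold (saddle-node) bifurcation at
`(x₀, μ₀)`, with the solutions on the side `μ > μ₀` if `0 < σ` and on the side `μ < μ₀` if `σ < 0`.

First part: near `(x₀, μ₀)` the zero set of `F` is a regular smooth curve `s ↦ (γ s, μ s)` through
`(x₀, μ₀)` that has a quadratic turning point with respect to the parameter there.
Second part: in arbitrarily small neighbourhoods `U` of `x₀` there are, for all `μ` close to `μ₀`,
exactly two solutions on one side of `μ₀`, only `x₀` for `μ = μ₀`, and none on the other side. -/
def IsFoldBifurcation {E : Type*} [NormedAddCommGroup E] [NormedSpace ℝ E]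
    (F : E → ℝ → E) (x₀ : E) (μ₀ σ : ℝ) : Prop :=
  (∃ (γ : ℝ → E) (μ : ℝ → ℝ) (δ : ℝ), 0 < δ ∧
      ContDiffOn ℝ ∞ γ (Set.Ioo (-δ) δ) ∧ ContDiffOn ℝ ∞ μ (Set.Ioo (-δ) δ) ∧
      Set.InjOn γ (Set.Ioo (-δ) δ) ∧ γ 0 = x₀ ∧ μ 0 = μ₀ ∧
      deriv γ 0 ≠ 0 ∧ deriv μ 0 = 0 ∧ 0 < σ * deriv (deriv μ) 0 ∧
      ∃ N ∈ 𝓝 (x₀, μ₀),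
        {p : E × ℝ | p ∈ N ∧ F p.1 p.2 = 0} = (fun s => (γ s, μ s)) '' Set.Ioo (-δ) δ) ∧
  ∀ W ∈ 𝓝 x₀, ∃ U ∈ 𝓝 x₀, U ⊆ W ∧ ∃ ε > 0, ∀ μ : ℝ, |μ - μ₀| < ε →
    (0 < σ * (μ - μ₀) → {x | x ∈ U ∧ F x μ = 0}.ncard = 2) ∧
    (μ = μ₀ → {x | x ∈ U ∧ F x μ = 0} = {x₀}) ∧
    (σ * (μ - μ₀) < 0 → {x | x ∈ U ∧ F x μ = 0} = ∅)

end FourBody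

end

open FourBody

noncomputable section

namespace FourBody

/-! A singular zero of `dziobek` is a degenerate solution of `F = 0`. Together with its null vector
it is expected to be a regular solution of the square system `F = 0`, `DF v = 0`, `v 7 = 1` in the
17 unknowns `(x, m, v)`, because the fold is nondegenerate. Regularity is certified directly: a
fixed rational matrix `A` is an approximate inverse of the derivative on a whole box, so `z - A
G(z)` contracts by 1/2 there. Contraction gives uniqueness on the box (`zero_unique_of_newton`), and
with a small residual also existence in a tiny ball (`exists_zero_of_newton`). The numerical inputs
are fixed-point interval computations on polynomial expressions with symbolic derivatives, evaluated
by the kernel.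

Uniqueness among all singular zeros in the given box needs control of unknown null vectors.
Replacing row 2 of `DF` by the last unit vector gives a uniformly invertible matrix, hence a
one-dimensional kernel and an enclosure of its normalized generator (`exists_kernel_vector`,
`norm_kernel_vector_sub_le`), which puts `(x, m, v)` in the 17-dimensional box. The same device
applied to the transpose encloses `w`.

Symmetry follows from uniqueness: exchanging bodies 1 and 2 preserves the box and the singular zeros
(`swap12_eq_of_singular`). A symmetric zero is realized by an explicit kite, and its central
configuration equations follow from the Dziobek equations (`exists_central_kite`).

For the fold, the map `(x, m) ↦ (F, ℓ (x - x₀))`, with `ℓ` the last coordinate, is a local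
diffeomorphism, so the zeros form a curve parametrized by `ℓ`. Differentiating `F = 0` twice along
it and pairing with `w` gives `μ' = 0` and `μ'' = -(w · D²F(v,v)) / (w · F_m)`; both numbers are
negative, so `μ'' < 0` (`fold_curve_derivs`, `isFoldBifurcation_of_simple_kernel`). -/

theorem beq_val_eq_false {n : ℕ} {i j : Fin n} (h : i ≠ j) : Nat.beq i.val j.val = false := by
  rw [Bool.eq_false_iff]
  exact fun h' => h (Fin.ext (Nat.eq_of_beq_eq_true h'))

/-! ### Polynomial expressions and their symbolic derivatives. -/

/-- Polynomial expressions with integer coefficients in `n` variables. -/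
inductive PolyExpr (n : ℕ) : Type
  | const (c : ℤ) : PolyExpr n
  | var (i : Fin n) : PolyExpr n
  | add (a b : PolyExpr n) : PolyExpr n
  | mul (a b : PolyExpr n) : PolyExpr n
  | pow (a : PolyExpr n) (k : ℕ) : PolyExpr n

namespace PolyExpr

variable {n : ℕ}

instance : Add (PolyExpr n) := ⟨add⟩
instance : Mul (PolyExpr n) := ⟨mul⟩
instance : Neg (PolyExpr n) := ⟨fun a => mul (const (-1)) a⟩
instance : Sub (PolyExpr n) := ⟨fun a b => add a (mul (const (-1)) b)⟩
instance : Pow (PolyExpr n) ℕ := ⟨pow⟩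

/-- The value of an expression at a point. -/
def eval (z : Fin n → ℝ) : PolyExpr n → ℝ
  | const c => c
  | var i => z i
  | add a b => eval z a + eval z b
  | mul a b => eval z a * eval z b
  | pow a k => eval z a ^ k

/-- Recognizes the constant `0`. -/
def isZero : PolyExpr n → Bool
  | const c => c == 0
  | _ => false

/-- Sum, omitting vanishing summands. -/
def sadd (a b : PolyExpr n) : PolyExpr n := bif a.isZero then b else bif b.isZero then a else add a b

/-- Product, simplified if a factor vanishes. -/
def smul (a b : PolyExpr n) : PolyExpr n :=
  bif a.isZero then const 0 else bif b.isZero then const 0 else mul a b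

/-- The partial derivative with respect to the variable `j`. -/
def diff (j : Fin n) : PolyExpr n → PolyExpr n
  | const _ => const 0
  | var i => const (bif Nat.beq i.val j.val then 1 else 0)
  | add a b => sadd (diff j a) (diff j b)
  | mul a b => sadd (smul (diff j a) b) (smul a (diff j b))
  -- For `k = 0` the truncated exponent `k - 1` is harmless, because the factor `k` vanishes.
  | pow a k => smul (mul (const k) (pow a (k - 1))) (diff j a)

@[simp] theorem eval_const (z : Fin n → ℝ) (c : ℤ) : (const c).eval z = c := rfl
@[simp] theorem eval_var (z : Fin n → ℝ) (i : Fin n) : (var i).eval z = z i := rfl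
@[simp] theorem eval_add (z : Fin n → ℝ) (a b : PolyExpr n) :
    (a + b).eval z = a.eval z + b.eval z := rfl
@[simp] theorem eval_mul (z : Fin n → ℝ) (a b : PolyExpr n) :
    (a * b).eval z = a.eval z * b.eval z := rfl
@[simp] theorem eval_pow (z : Fin n → ℝ) (a : PolyExpr n) (k : ℕ) :
    (a ^ k).eval z = a.eval z ^ k := rfl
@[simp] theorem eval_neg (z : Fin n → ℝ) (a : PolyExpr n) : (-a).eval z = -a.eval z := by
  change (((-1 : ℤ) : ℝ)) * a.eval z = _
  simp
@[simp] theorem eval_sub (z : Fin n → ℝ) (a b : PolyExpr n) :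
    (a - b).eval z = a.eval z - b.eval z := by
  change a.eval z + (((-1 : ℤ) : ℝ)) * b.eval z = _
  simp [sub_eq_add_neg]

theorem eval_eq_zero_of_isZero {a : PolyExpr n} (h : a.isZero = true) (z : Fin n → ℝ) :
    a.eval z = 0 := by
  cases a <;> simp_all [isZero]

@[simp] theorem eval_sadd (z : Fin n → ℝ) (a b : PolyExpr n) :
    (sadd a b).eval z = a.eval z + b.eval z := by
  unfold sadd
  cases ha : a.isZero
  · cases hb : b.isZero
    · rfl
    · simp [eval_eq_zero_of_isZero hb]
  · simp [eval_eq_zero_of_isZero ha]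

@[simp] theorem eval_smul (z : Fin n → ℝ) (a b : PolyExpr n) :
    (smul a b).eval z = a.eval z * b.eval z := by
  unfold smul
  cases ha : a.isZero
  · cases hb : b.isZero
    · rfl
    · simp [eval_eq_zero_of_isZero hb]
  · simp [eval_eq_zero_of_isZero ha]

/-- This makes an interval evaluation of `diff` a statement about the true derivative. -/
theorem hasFDerivAt_eval (e : PolyExpr n) (z : Fin n → ℝ) :
    HasFDerivAt (fun y => e.eval y)
      (∑ j, (e.diff j).eval z • ContinuousLinearMap.proj (R := ℝ) (φ := fun _ => ℝ) j) z := by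
  induction e with
  | const c =>
    refine (hasFDerivAt_const (c : ℝ) z).congr_fderiv ?_
    ext h
    simp [diff]
  | var i =>
    refine (hasFDerivAt_apply (𝕜 := ℝ) i z).congr_fderiv ?_
    ext h
    have : ∀ j : Fin n, ((bif Nat.beq i.val j.val then (1 : ℤ) else 0 : ℤ) : ℝ) =
        if i = j then 1 else 0 := by
      intro j
      by_cases hij : i = j
      · simp [hij]
      · have : Nat.beq i.val j.val = false := beq_val_eq_false hij
        simp [hij, this]
    simp [diff, this]
  | add a b iha ihb =>
    refine (iha.add ihb).congr_fderiv ?_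
    ext h
    simp [diff, add_mul, Finset.sum_add_distrib]
  | mul a b iha ihb =>
    refine (iha.mul ihb).congr_fderiv ?_
    ext h
    simp only [diff, eval_sadd, eval_smul, add_apply,
      smul_apply, sum_apply,
      ContinuousLinearMap.proj_apply, smul_eq_mul, Finset.mul_sum, ← Finset.sum_add_distrib]
    exact Finset.sum_congr rfl fun j _ => by ring
  | pow a k iha =>
    refine (iha.pow k).congr_fderiv ?_
    ext h
    simp only [diff, eval_smul, smul_apply, sum_apply,
      ContinuousLinearMap.proj_apply, smul_eq_mul, Finset.mul_sum, nsmul_eq_mul]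
    refine Finset.sum_congr rfl fun j _ => ?_
    change _ = (((k : ℤ) : ℝ) * a.eval z ^ (k - 1)) * _ * _
    push_cast
    ring

theorem contDiff_eval (e : PolyExpr n) {k : WithTop ℕ∞} :
    ContDiff ℝ k (fun z : Fin n → ℝ => e.eval z) := by
  induction e with
  | const c => exact contDiff_const
  | var i => exact contDiff_apply ℝ ℝ i
  | add a b iha ihb => exact iha.add ihb
  | mul a b iha ihb => exact iha.mul ihb
  | pow a k iha => exact iha.pow k

end PolyExpr

/-! ### Interval arithmetic with integers. -/

/-- The denominator of the fixed point numbers used in interval computations. -/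
def ballScale : ℕ := 10 ^ 40

/-- The interval with centre `c` and radius `r`, in units of `1 / ballScale`. -/
structure Ball where
  c : ℤ
  r : ℕ

namespace Ball

/-- `x` lies in the interval `b`. -/
def Mem (b : Ball) (x : ℝ) : Prop := |x * ballScale - b.c| ≤ b.r

/-- The exact integer `k`. -/
def ofInt (k : ℤ) : Ball := ⟨k * ballScale, 0⟩

/-- Sum of intervals. -/
def add (a b : Ball) : Ball := ⟨a.c + b.c, a.r + b.r⟩

/-- Product of intervals, rounded outwards. -/
def mul (a b : Ball) : Ball :=
  -- Both divisions round down, and each loses at most one unit; hence `+ 2`.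
  ⟨a.c * b.c / ballScale, (a.c.natAbs * b.r + b.c.natAbs * a.r + a.r * b.r) / ballScale + 2⟩

/-- Powers of an interval. -/
def pow (a : Ball) : ℕ → Ball
  | 0 => ofInt 1
  | k + 1 => mul a (pow a k)

/-- Multiplication by an integer, without rounding. -/
def smulInt (k : ℤ) (b : Ball) : Ball := ⟨k * b.c, k.natAbs * b.r⟩

/-- Sum of a list of intervals. -/
def sum : List Ball → Ball
  | [] => ofInt 0
  | a :: l => add a (sum l)

/-- Interval version of the dot product. -/
def dot {n : ℕ} (a b : Fin n → Ball) : Ball := sum ((List.finRange n).map fun j => mul (a j) (b j))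

/-- A bound for `ballScale * |x|`, `x` in the interval. -/
def absBound (b : Ball) : ℕ := b.c.natAbs + b.r

theorem ballScale_pos : (0 : ℝ) < ballScale := by norm_num [ballScale]

theorem mem_ofInt (k : ℤ) : (ofInt k).Mem k := by simp [Mem, ofInt]

theorem mem_add {x y : ℝ} {a b : Ball} (hx : Mem a x) (hy : Mem b y) : Mem (add a b) (x + y) := by
  simp only [Mem, add] at *
  push_cast
  rw [abs_le] at *
  constructor <;> linarith [hx.1, hx.2, hy.1, hy.2]

theorem mem_smulInt {x : ℝ} {b : Ball} (k : ℤ) (hx : Mem b x) : Mem (smulInt k b) (k * x) := by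
  simp only [Mem, smulInt] at *
  push_cast
  rw [mul_assoc, ← mul_sub, abs_mul, Nat.cast_natAbs, Int.cast_abs]
  gcongr

theorem mem_mul {x y : ℝ} {a b : Ball} (hx : Mem a x) (hy : Mem b y) : Mem (mul a b) (x * y) := by
  simp only [Mem, mul] at *
  have hS := ballScale_pos
  set S : ℝ := ((ballScale : ℕ) : ℝ)
  set R : ℕ := a.c.natAbs * b.r + b.c.natAbs * a.r + a.r * b.r with hR
  have h1 : |x * S * (y * S) - a.c * b.c| ≤ R := by
    have : x * S * (y * S) - a.c * b.c =
        a.c * (y * S - b.c) + b.c * (x * S - a.c) + (x * S - a.c) * (y * S - b.c) := by ring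
    rw [this, hR]
    push_cast
    simp only [Nat.cast_natAbs, Int.cast_abs]
    refine (abs_add_three _ _ _).trans ?_
    simp only [abs_mul]
    gcongr
  have h2 : |x * y * S - (a.c * b.c : ℝ) / S| ≤ R / S := by
    have : x * y * S - (a.c * b.c : ℝ) / S = (x * S * (y * S) - a.c * b.c) / S := by
      field_simp
    rw [this, abs_div, abs_of_pos hS]
    gcongr
  have h3 : (R : ℝ) / S ≤ ((R / ballScale : ℕ) : ℝ) + 1 := by
    have h := Nat.lt_div_mul_add (a := R) (b := ballScale) (by norm_num [ballScale])
    rw [div_le_iff₀ hS]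
    have : (R : ℝ) < (R / ballScale : ℕ) * ballScale + ballScale := by exact_mod_cast h
    linarith
  have h4 : |(a.c * b.c : ℝ) / S - ((a.c * b.c / (ballScale : ℤ) : ℤ) : ℝ)| ≤ 1 := by
    have e := Int.emod_add_mul_ediv (a.c * b.c) (ballScale : ℤ)
    have p1 := Int.emod_nonneg (a.c * b.c) (b := (ballScale : ℤ)) (by norm_num [ballScale])
    have p2 := Int.emod_lt_of_pos (a.c * b.c) (b := (ballScale : ℤ)) (by norm_num [ballScale])
    set q := a.c * b.c / (ballScale : ℤ)
    set t := a.c * b.c % (ballScale : ℤ)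
    have e' : (t : ℝ) + S * q = a.c * b.c := by
      have : (t : ℝ) + (ballScale : ℕ) * q = a.c * b.c := by exact_mod_cast e
      exact this
    have p1' : (0 : ℝ) ≤ t := by exact_mod_cast p1
    have p2' : (t : ℝ) < S := by
      have : (t : ℝ) < (ballScale : ℕ) := by exact_mod_cast p2
      exact this
    have : (a.c * b.c : ℝ) / S - q = t / S := by
      rw [← e']
      field_simp
      ring
    rw [this, abs_of_nonneg (by positivity), div_le_one hS]
    exact p2'.le
  calc _ ≤ |x * y * S - (a.c * b.c : ℝ) / S| +
        |(a.c * b.c : ℝ) / S - ((a.c * b.c / (ballScale : ℤ) : ℤ) : ℝ)| := abs_sub_le _ _ _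
    _ ≤ _ := by
      push_cast
      linarith

theorem mem_pow {x : ℝ} {a : Ball} (hx : Mem a x) (k : ℕ) : Mem (pow a k) (x ^ k) := by
  induction k with
  | zero => simpa [pow] using mem_ofInt 1
  | succ k ih =>
    rw [pow_succ']
    exact mem_mul hx ih

theorem mem_sum {ι : Type*} (l : List ι) {f : ι → ℝ} {b : ι → Ball} (h : ∀ i, Mem (b i) (f i)) :
    Mem (sum (l.map b)) (l.map f).sum := by
  induction l with
  | nil => simpa [sum] using mem_ofInt 0
  | cons i l ih => simpa [sum] using mem_add (h i) ih

theorem mem_finSum {n : ℕ} {f : Fin n → ℝ} {b : Fin n → Ball} (h : ∀ i, Mem (b i) (f i)) :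
    Mem (sum ((List.finRange n).map b)) (∑ i, f i) := by
  rw [Fin.sum_univ_def]
  exact mem_sum _ h

theorem mem_dot {n : ℕ} {x y : Fin n → ℝ} {a b : Fin n → Ball} (hx : ∀ i, Mem (a i) (x i))
    (hy : ∀ i, Mem (b i) (y i)) : Mem (dot a b) (x ⬝ᵥ y) :=
  mem_finSum fun i => mem_mul (hx i) (hy i)

theorem abs_le_absBound {x : ℝ} {b : Ball} (h : Mem b x) : |x| * ballScale ≤ b.absBound := by
  have hS := ballScale_pos
  rw [← abs_of_pos hS, ← abs_mul]
  simp only [Mem, absBound] at *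
  push_cast
  rw [Nat.cast_natAbs, Int.cast_abs]
  have := abs_add_le (x * ballScale - b.c) b.c
  rw [sub_add_cancel] at this
  linarith

end Ball

/-- Interval extension of `PolyExpr.eval`. -/
def PolyExpr.ballEval {n : ℕ} (z : Fin n → Ball) : PolyExpr n → Ball
  | const c => .ofInt c
  | var i => z i
  | add a b => .add (ballEval z a) (ballEval z b)
  | mul a b => .mul (ballEval z a) (ballEval z b)
  | pow a k => .pow (ballEval z a) k

theorem PolyExpr.mem_ballEval {n : ℕ} {z : Fin n → ℝ} {b : Fin n → Ball}
    (h : ∀ i, (b i).Mem (z i)) (e : PolyExpr n) : (e.ballEval b).Mem (e.eval z) := by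
  induction e with
  | const c => exact Ball.mem_ofInt c
  | var i => exact h i
  | add _ _ iha ihb => exact Ball.mem_add iha ihb
  | mul _ _ iha ihb => exact Ball.mem_mul iha ihb
  | pow _ k iha => exact Ball.mem_pow iha k

/-! ### Approximate inverses, the Newton operator and null vectors. -/

section ApproxInverse

open Matrix

variable {n : ℕ}

/-- The norm of `Fin n → ℝ` is the supremum norm, for which the operator norm is the largest
absolute row sum. -/
theorem norm_mulVec_le {M : Matrix (Fin n) (Fin n) ℝ} {c : ℝ} (hc : 0 ≤ c)
    (hM : ∀ i, ∑ k, |M i k| ≤ c) (h : Fin n → ℝ) : ‖M *ᵥ h‖ ≤ c * ‖h‖ := by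
  refine (pi_norm_le_iff_of_nonneg (by positivity)).2 fun i => ?_
  calc ‖(M *ᵥ h) i‖ ≤ ∑ k, ‖M i k * h k‖ := norm_sum_le Finset.univ fun k => M i k * h k
    _ ≤ ∑ k, |M i k| * ‖h‖ := by
        refine Finset.sum_le_sum fun k _ => ?_
        rw [norm_mul, Real.norm_eq_abs]
        gcongr
        exact norm_le_pi_norm h k
    _ = (∑ k, |M i k|) * ‖h‖ := by rw [Finset.sum_mul]
    _ ≤ c * ‖h‖ := by gcongr; exact hM i

/-- `A` is an approximate left inverse of `M`, with respect to the row sum norm. -/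
def IsApproxInv (A M : Matrix (Fin n) (Fin n) ℝ) : Prop :=
  ∀ i, ∑ k, |(1 - A * M) i k| ≤ 1 / 2

namespace IsApproxInv

variable {A M : Matrix (Fin n) (Fin n) ℝ}

theorem norm_sub_le (hA : IsApproxInv A M) (h : Fin n → ℝ) :
    ‖h - A *ᵥ (M *ᵥ h)‖ ≤ 1 / 2 * ‖h‖ := by
  simpa [Matrix.sub_mulVec, Matrix.mulVec_mulVec] using norm_mulVec_le (by norm_num) hA h

theorem norm_le (hA : IsApproxInv A M) (h : Fin n → ℝ) : ‖h‖ ≤ 2 * ‖A *ᵥ (M *ᵥ h)‖ := by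
  have h1 := hA.norm_sub_le h
  have h2 := norm_add_le (h - A *ᵥ (M *ᵥ h)) (A *ᵥ (M *ᵥ h))
  rw [sub_add_cancel] at h2
  linarith

theorem eq_zero_of_mulVec (hA : IsApproxInv A M) {h : Fin n → ℝ} (h0 : M *ᵥ h = 0) : h = 0 := by
  have := hA.norm_le h
  rw [h0, Matrix.mulVec_zero, norm_zero, mul_zero] at this
  exact norm_le_zero_iff.1 this

/-- A fixed point of the Newton map only gives `A *ᵥ G z = 0`. Since `A * M` is injective, `det A *
det M ≠ 0`, so `A` is invertible and can be removed. -/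
theorem eq_zero_of_left_mulVec (hA : IsApproxInv A M) {g : Fin n → ℝ} (h0 : A *ᵥ g = 0) :
    g = 0 := by
  have hAM : (A * M).det ≠ 0 := by
    intro hdet
    obtain ⟨h, hne, hh⟩ := Matrix.exists_mulVec_eq_zero_iff.2 hdet
    apply hne
    have := hA.norm_le h
    rw [Matrix.mulVec_mulVec, hh, norm_zero, mul_zero] at this
    exact norm_le_zero_iff.1 this
  rw [Matrix.det_mul] at hAM
  exact Matrix.eq_zero_of_mulVec_eq_zero (left_ne_zero_of_mul hAM) h0

end IsApproxInv

section Newton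

variable {G : (Fin n → ℝ) → Fin n → ℝ} {D : (Fin n → ℝ) → Matrix (Fin n) (Fin n) ℝ}
  {A : Matrix (Fin n) (Fin n) ℝ} {s : Set (Fin n → ℝ)}

/-- The derivative of `z - A G(z)` is `1 - A D(z)`, of norm at most 1/2; convexity permits the mean
value inequality. -/
theorem lipschitzOnWith_newton
    (hG : ∀ z, HasFDerivAt G (Matrix.mulVecLin (D z)).toContinuousLinearMap z)
    (hs : Convex ℝ s) (hA : ∀ z ∈ s, IsApproxInv A (D z)) :
    LipschitzOnWith (1 / 2) (fun z => z - A *ᵥ G z) s := by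
  let LA : (Fin n → ℝ) →L[ℝ] (Fin n → ℝ) := (Matrix.mulVecLin A).toContinuousLinearMap
  refine hs.lipschitzOnWith_of_nnnorm_hasFDerivWithin_le
    (f' := fun z => ContinuousLinearMap.id ℝ _ -
      LA.comp (Matrix.mulVecLin (D z)).toContinuousLinearMap) (fun z _ => ?_) fun z hz => ?_
  · exact ((hasFDerivAt_id z).sub (LA.hasFDerivAt.comp z (hG z))).hasFDerivWithinAt
  · rw [← NNReal.coe_le_coe, coe_nnnorm]
    refine ContinuousLinearMap.opNorm_le_bound _ (by positivity) fun h => ?_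
    simpa [LA] using (hA z hz).norm_sub_le h

theorem zero_unique_of_newton
    (hG : ∀ z, HasFDerivAt G (Matrix.mulVecLin (D z)).toContinuousLinearMap z)
    (hs : Convex ℝ s) (hA : ∀ z ∈ s, IsApproxInv A (D z)) {z z' : Fin n → ℝ}
    (hz : z ∈ s) (hz' : z' ∈ s) (h : G z = 0) (h' : G z' = 0) : z = z' := by
  have := (lipschitzOnWith_newton hG hs hA).dist_le_mul z hz z' hz'
  simp only [h, h', Matrix.mulVec_zero, sub_zero] at this
  have h2 := dist_nonneg (x := z) (y := z')
  refine dist_le_zero.1 ?_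
  push_cast at this
  linarith

/-- Banach's fixed point theorem: the centre moves by at most `ρ / 2` and distances to it are
halved, so the ball is mapped into itself. -/
theorem exists_zero_of_newton
    (hG : ∀ z, HasFDerivAt G (Matrix.mulVecLin (D z)).toContinuousLinearMap z)
    {c : Fin n → ℝ} {ρ : ℝ} (hρ : 0 ≤ ρ)
    (hA : ∀ z ∈ Metric.closedBall c ρ, IsApproxInv A (D z)) (hc : ‖A *ᵥ G c‖ ≤ ρ / 2) :
    ∃ z ∈ Metric.closedBall c ρ, G z = 0 := by
  have hL := lipschitzOnWith_newton hG (convex_closedBall c ρ) hA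
  have hcs : c ∈ Metric.closedBall c ρ := Metric.mem_closedBall_self hρ
  have hmaps : Set.MapsTo (fun z => z - A *ᵥ G z) (Metric.closedBall c ρ)
      (Metric.closedBall c ρ) := by
    intro z hz
    have h1 := hL.dist_le_mul z hz c hcs
    have h2 := dist_triangle (z - A *ᵥ G z) (c - A *ᵥ G c) c
    have h3 : dist (c - A *ᵥ G c) c ≤ ρ / 2 := by simpa [dist_eq_norm] using hc
    rw [Metric.mem_closedBall] at hz ⊢
    push_cast at h1
    simp only at h1 ⊢
    linarith
  have hcon : ContractingWith (1 / 2) (hmaps.restrict _ _ _) :=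
    ⟨by rw [← NNReal.coe_lt_coe]; norm_num, by
      have := hL.mapsToRestrict hmaps
      exact this⟩
  obtain ⟨z, hz, hfix, -⟩ := hcon.exists_fixedPoint' (Metric.isClosed_closedBall.isComplete)
    hmaps hcs (edist_ne_top _ _)
  refine ⟨z, hz, (hA z hz).eq_zero_of_left_mulVec ?_⟩
  have : z - A *ᵥ G z = z := hfix
  simpa using this

end Newton

/-- A singular matrix that becomes invertible when its row `k` is replaced by the unit vector with
index `l` has a one-dimensional kernel, spanned by a vector that is `1` at `l`. -/
theorem exists_kernel_vector {J B : Matrix (Fin n) (Fin n) ℝ} {k l : Fin n}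
    (hJ : J.det = 0) (hB : IsApproxInv B (J.updateRow k (Pi.single l 1))) :
    ∃ v : Fin n → ℝ, J *ᵥ v = 0 ∧ v l = 1 ∧ (∀ u, J *ᵥ u = 0 → u = u l • v) := by
  -- On the kernel of `J` the bordered matrix sees only the entry `u l`; being injective, it lets
  -- this entry determine `u`.
  have key : ∀ u, J *ᵥ u = 0 → J.updateRow k (Pi.single l 1) *ᵥ u = Pi.single k (u l) := by
    intro u hu
    funext i
    by_cases hi : i = k
    · subst hi
      simp [Matrix.mulVec]
    · have := congrFun hu i
      simpa [Matrix.mulVec, hi, Matrix.updateRow_ne] using this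
  obtain ⟨u, hu0, hu⟩ := Matrix.exists_mulVec_eq_zero_iff.2 hJ
  have hul : u l ≠ 0 := by
    intro h
    apply hu0
    apply hB.eq_zero_of_mulVec
    rw [key u hu, h, Pi.single_zero]
  refine ⟨(u l)⁻¹ • u, by rw [Matrix.mulVec_smul, hu, smul_zero], by simp [hul], fun y hy => ?_⟩
  rw [← sub_eq_zero]
  apply hB.eq_zero_of_mulVec
  have hz : J *ᵥ (y - y l • (u l)⁻¹ • u) = 0 := by
    rw [Matrix.mulVec_sub, Matrix.mulVec_smul, Matrix.mulVec_smul, hu, hy]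
    simp
  rw [key _ hz]
  simp [hul]

/-- Enclosure of the normalized kernel vector of a matrix. -/
theorem norm_kernel_vector_sub_le {J B : Matrix (Fin n) (Fin n) ℝ} {k l : Fin n}
    (hB : IsApproxInv B (J.updateRow k (Pi.single l 1))) {v : Fin n → ℝ} (hv : J *ᵥ v = 0)
    (hvl : v l = 1) {c : Fin n → ℝ} (hcl : c l = 1) :
    ‖v - c‖ ≤ 2 * ‖B *ᵥ (J.updateRow k 0 *ᵥ c)‖ := by
  refine (hB.norm_le _).trans_eq ?_
  -- The new row gives `0` because `v` and `c` agree at `l`; the other rows annihilate `v` and leave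
  -- the residual of `c`.
  have : J.updateRow k (Pi.single l 1) *ᵥ (v - c) = -(J.updateRow k 0 *ᵥ c) := by
    funext i
    by_cases hi : i = k
    · subst hi
      simp [Matrix.mulVec, hvl, hcl]
    · have := congrFun hv i
      simp only [Matrix.mulVec, Pi.zero_apply, Pi.neg_apply, ne_eq, hi, not_false_eq_true,
        Matrix.updateRow_ne] at this ⊢
      rw [dotProduct_sub, this, zero_sub]
  rw [this, Matrix.mulVec_neg, norm_neg]

section Checks

/-- Certificate that `A / s` is an approximate inverse of all matrices in the interval matrix `T`. -/
def invCheck (A : Fin n → Fin n → ℤ) (s : ℕ) (T : Fin n → Fin n → Ball) : Bool :=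
  (List.finRange n).all fun i => Nat.ble (2 * ((List.finRange n).map fun k =>
    (Ball.add (Ball.ofInt (bif Nat.beq i.val k.val then -(s : ℤ) else 0))
      (Ball.sum ((List.finRange n).map fun j => Ball.smulInt (A i j) (T j k)))).absBound).sum)
    (s * ballScale)

/-- Certificate that the entries of `A / s` times a vector in `g` are at most `ρ / ballScale`. -/
def mulVecCheck (A : Fin n → Fin n → ℤ) (s : ℕ) (g : Fin n → Ball) (ρ : ℕ) : Bool :=
  (List.finRange n).all fun i => Nat.ble
    (Ball.sum ((List.finRange n).map fun j => Ball.smulInt (A i j) (g j))).absBound (s * ρ)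

/-- The matrix `A / s`. -/
def scaledMatrix (A : Fin n → Fin n → ℤ) (s : ℕ) : Matrix (Fin n) (Fin n) ℝ :=
  Matrix.of fun i j => (A i j : ℝ) / s

/-- The certificate bounds the row sums of `A T - s · 1` in integers, that is, those of `1 - (A / s)
M` scaled by `s * ballScale`; its factor 2 is the constant 1/2. -/
theorem isApproxInv_of_invCheck {A : Fin n → Fin n → ℤ} {s : ℕ} {T : Fin n → Fin n → Ball}
    (hs : 0 < s) (hc : invCheck A s T = true) {M : Matrix (Fin n) (Fin n) ℝ}
    (hM : ∀ j k, (T j k).Mem (M j k)) : IsApproxInv (scaledMatrix A s) M := by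
  intro i
  have hs' : (0 : ℝ) < s := by exact_mod_cast hs
  have hS := Ball.ballScale_pos
  have h1 := Nat.le_of_ble_eq_true (List.all_eq_true.1 hc i (List.mem_finRange i))
  rw [← Fin.sum_univ_def] at h1
  have h2 : ∀ k, |(1 - scaledMatrix A s * M) i k| * s * ballScale ≤
      (Ball.add (Ball.ofInt (bif Nat.beq i.val k.val then -(s : ℤ) else 0))
      (Ball.sum ((List.finRange n).map fun j => Ball.smulInt (A i j) (T j k)))).absBound := by
    intro k
    refine le_trans (le_of_eq ?_) (Ball.abs_le_absBound (Ball.mem_add (Ball.mem_ofInt _)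
      (Ball.mem_finSum fun j => Ball.mem_smulInt (A i j) (hM j k))))
    congr 1
    rw [← abs_of_pos hs', ← abs_mul, ← abs_neg]
    congr 1
    have h3 : (s : ℝ) * ∑ j, scaledMatrix A s i j * M j k = ∑ j, (A i j : ℝ) * M j k := by
      rw [Finset.mul_sum]
      refine Finset.sum_congr rfl fun j _ => ?_
      simp only [scaledMatrix, Matrix.of_apply]
      field_simp
    rw [← h3, Matrix.sub_apply, Matrix.mul_apply, Matrix.one_apply]
    by_cases hik : i = k
    · simp [hik]
      ring
    · have : Nat.beq i.val k.val = false := beq_val_eq_false hik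
      simp [hik, this]
      ring
  have h4 : (∑ k, |(1 - scaledMatrix A s * M) i k|) * (s * ballScale) * 2 ≤ s * ballScale := by
    rw [Finset.sum_mul]
    have h5 := Finset.sum_le_sum fun k (_ : k ∈ Finset.univ) => h2 k
    simp only [mul_assoc] at h5
    have h6 := (Nat.cast_le (α := ℝ)).2 h1
    push_cast at h6
    linarith
  have h7 : (0 : ℝ) < s * ballScale := by positivity
  rw [le_div_iff₀ two_pos]
  by_contra hcon
  push Not at hcon
  nlinarith

theorem norm_mulVec_le_of_mulVecCheck {A : Fin n → Fin n → ℤ} {s : ℕ} {g : Fin n → Ball} {ρ : ℕ}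
    (hs : 0 < s) (hc : mulVecCheck A s g ρ = true) {y : Fin n → ℝ} (hy : ∀ j, (g j).Mem (y j)) :
    ‖scaledMatrix A s *ᵥ y‖ ≤ ρ / ballScale := by
  have hs' : (0 : ℝ) < s := by exact_mod_cast hs
  have hS := Ball.ballScale_pos
  refine (pi_norm_le_iff_of_nonneg (by positivity)).2 fun i => ?_
  have h1 := Nat.le_of_ble_eq_true (List.all_eq_true.1 hc i (List.mem_finRange i))
  have h2 := Ball.abs_le_absBound (Ball.mem_finSum fun j => Ball.mem_smulInt (A i j) (hy j))
  have h3 : (scaledMatrix A s *ᵥ y) i = (∑ j, (A i j : ℝ) * y j) / s := by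
    rw [Finset.sum_div, Matrix.mulVec, dotProduct]
    refine Finset.sum_congr rfl fun j _ => ?_
    simp only [scaledMatrix, Matrix.of_apply]
    ring
  rw [h3, Real.norm_eq_abs, abs_div, abs_of_pos hs', div_le_div_iff₀ hs' hS]
  have h6 := (Nat.cast_le (α := ℝ)).2 h1
  push_cast at h6
  linarith

end Checks

end ApproxInverse

/-! ### The Dziobek map and the extended system for singular zeros as polynomial expressions. -/

open PolyExpr in
/-- The expression that corresponds to `sPartial`; the arguments are the indices of the distances. -/
def sPartialExpr (a b c d e f : Fin 17) : PolyExpr 17 :=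
  var f ^ 2 * (var b ^ 2 + var c ^ 2 + var d ^ 2 + var e ^ 2 - const 2 * var a ^ 2 - var f ^ 2) -
    (var b ^ 2 - var c ^ 2) * (var d ^ 2 - var e ^ 2)

open PolyExpr in
/-- The Dziobek map as a family of expressions in the variables `(x, m, v)`. -/
def dziobekExpr : Fin 8 → PolyExpr 17 :=
  ![var 2 ^ 2 + var 3 ^ 2 + var 8 * var 4 ^ 2 + var 5 ^ 2 + var 8 * var 6 ^ 2 + var 8 * var 7 ^ 2 -
      (const 3 + var 8),
    const 2 * (var 2 ^ 2 * var 7 ^ 2 * 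
          (var 3 ^ 2 + var 4 ^ 2 + var 5 ^ 2 + var 6 ^ 2 - var 2 ^ 2 - var 7 ^ 2)
        + var 3 ^ 2 * var 6 ^ 2 * 
          (var 2 ^ 2 + var 4 ^ 2 + var 5 ^ 2 + var 7 ^ 2 - var 3 ^ 2 - var 6 ^ 2)
        + var 4 ^ 2 * var 5 ^ 2 * 
          (var 2 ^ 2 + var 3 ^ 2 + var 6 ^ 2 + var 7 ^ 2 - var 4 ^ 2 - var 5 ^ 2)
        - var 2 ^ 2 * var 3 ^ 2 * var 5 ^ 2 - var 2 ^ 2 * var 4 ^ 2 * var 6 ^ 2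
        - var 3 ^ 2 * var 4 ^ 2 * var 7 ^ 2 - var 5 ^ 2 * var 6 ^ 2 * var 7 ^ 2),
    -(const 3 + var 8) + const 2 * var 0 * var 2 ^ 3 +
      const 4 * (const 3 + var 8) * var 1 * var 2 ^ 3 * sPartialExpr 2 3 4 5 6 7,
    -(const 3 + var 8) + const 2 * var 0 * var 3 ^ 3 +
      const 4 * (const 3 + var 8) * var 1 * var 3 ^ 3 * sPartialExpr 3 2 4 5 7 6,
    -(const 3 + var 8) * var 8 + const 2 * var 0 * var 8 * var 4 ^ 3 +
      const 4 * (const 3 + var 8) * var 1 * var 4 ^ 3 * sPartialExpr 4 2 3 6 7 5,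
    -(const 3 + var 8) + const 2 * var 0 * var 5 ^ 3 +
      const 4 * (const 3 + var 8) * var 1 * var 5 ^ 3 * sPartialExpr 5 2 6 3 7 4,
    -(const 3 + var 8) * var 8 + const 2 * var 0 * var 8 * var 6 ^ 3 +
      const 4 * (const 3 + var 8) * var 1 * var 6 ^ 3 * sPartialExpr 6 2 5 4 7 3,
    -(const 3 + var 8) * var 8 + const 2 * var 0 * var 8 * var 7 ^ 3 +
      const 4 * (const 3 + var 8) * var 1 * var 7 ^ 3 * sPartialExpr 7 3 5 4 6 2]

open PolyExpr in
/-- The derivative in the direction `v` with respect to `x`. -/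
def dirDeriv (e : PolyExpr 17) : PolyExpr 17 :=
  [((0 : Fin 17), (9 : Fin 17)), (1, 10), (2, 11), (3, 12), (4, 13), (5, 14), (6, 15), (7, 16)].foldr
    (fun p s => sadd (smul (diff p.1 e) (var p.2)) s) (const 0)

open PolyExpr in
/-- The system `F = 0`, `DF v = 0`, `v₇ = 1` for the singular zeros of the Dziobek map. -/
def singularExpr : Fin 17 → PolyExpr 17 :=
  ![dziobekExpr 0, dziobekExpr 1, dziobekExpr 2, dziobekExpr 3, dziobekExpr 4, dziobekExpr 5,
    dziobekExpr 6, dziobekExpr 7,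
    dirDeriv (dziobekExpr 0), dirDeriv (dziobekExpr 1), dirDeriv (dziobekExpr 2),
    dirDeriv (dziobekExpr 3), dirDeriv (dziobekExpr 4), dirDeriv (dziobekExpr 5),
    dirDeriv (dziobekExpr 6), dirDeriv (dziobekExpr 7), var 16 - const 1]

/-- The point `(x, m, v)` of `ℝ¹⁷`. -/
def joint (x : Fin 8 → ℝ) (m : ℝ) (v : Fin 8 → ℝ) : Fin 17 → ℝ :=
  ![x 0, x 1, x 2, x 3, x 4, x 5, x 6, x 7, m, v 0, v 1, v 2, v 3, v 4, v 5, v 6, v 7]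

theorem eval_dziobekExpr (x : Fin 8 → ℝ) (m : ℝ) (v : Fin 8 → ℝ) (i : Fin 8) :
    (dziobekExpr i).eval (joint x m v) = dziobek x m i := by
  fin_cases i <;>
    simp [dziobekExpr, dziobek, joint, sPartialExpr, sPartial, weightedSquares, cayleyMenger_eq]

theorem hasFDerivAt_joint (x : Fin 8 → ℝ) (m : ℝ) (v : Fin 8 → ℝ) :
    ∃ L : (Fin 8 → ℝ) →L[ℝ] (Fin 17 → ℝ), (∀ h, L h = joint h 0 0) ∧
      HasFDerivAt (fun y => joint y m v) L x := by
  let L₀ : (Fin 8 → ℝ) →ₗ[ℝ] (Fin 17 → ℝ) :=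
    { toFun := fun h => joint h 0 0
      map_add' := fun a b => by
        simp [joint]
      map_smul' := fun a b => by
        simp [joint] }
  refine ⟨L₀.toContinuousLinearMap, fun h => rfl, ?_⟩
  have h : (fun y => joint y m v) = fun y => L₀.toContinuousLinearMap y + joint 0 m v := by
    funext y
    change joint y m v = joint y 0 0 + joint 0 m v
    simp [joint]
  rw [h]
  exact L₀.toContinuousLinearMap.hasFDerivAt.add_const _

theorem hasFDerivAt_eval_joint (e : PolyExpr 17) (x : Fin 8 → ℝ) (m : ℝ) (v : Fin 8 → ℝ) :
    HasFDerivAt (fun y => e.eval (joint y m v))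
      (∑ j : Fin 8, (e.diff (j.castLE (by norm_num))).eval (joint x m v) •
        ContinuousLinearMap.proj (R := ℝ) (φ := fun _ => ℝ) j) x := by
  obtain ⟨L, hL, hd⟩ := hasFDerivAt_joint x m v
  refine ((e.hasFDerivAt_eval (joint x m v)).comp x hd).congr_fderiv ?_
  ext h
  simp only [ContinuousLinearMap.comp_apply, hL, sum_apply, smul_apply,
    ContinuousLinearMap.proj_apply, smul_eq_mul]
  simp [Fin.sum_univ_succ, joint]

theorem eval_dirDeriv (e : PolyExpr 17) (x : Fin 8 → ℝ) (m : ℝ) (v : Fin 8 → ℝ) :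
    (dirDeriv e).eval (joint x m v) =
      ∑ j : Fin 8, (e.diff (j.castLE (by norm_num))).eval (joint x m v) * v j := by
  simp [dirDeriv, Fin.sum_univ_succ, joint]

theorem hasDerivAt_eval_joint_mass (e : PolyExpr 17) (x : Fin 8 → ℝ) (m : ℝ) (v : Fin 8 → ℝ) :
    HasDerivAt (fun t => e.eval (joint x t v)) ((e.diff 8).eval (joint x m v)) m := by
  have h : HasDerivAt (fun t => joint x t v) (Pi.single 8 1) m := by
    have h : (fun t => joint x t v) =
        fun t => joint x 0 v + t • (Pi.single 8 1 : Fin 17 → ℝ) := by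
      funext t i
      revert i
      simp [joint, Fin.forall_fin_succ]
    rw [h]
    simpa using ((hasDerivAt_id m).smul_const (Pi.single 8 1 : Fin 17 → ℝ)).const_add (joint x 0 v)
  refine ((e.hasFDerivAt_eval (joint x m v)).comp_hasDerivAt m h).congr_deriv ?_
  simp [Pi.single_apply]

theorem contDiff_joint {k : WithTop ℕ∞} (v : Fin 8 → ℝ) :
    ContDiff ℝ k (fun p : (Fin 8 → ℝ) × ℝ => joint p.1 p.2 v) := by
  rw [contDiff_pi]
  simp only [Fin.forall_fin_succ, joint]
  simp
  and_intros <;> fun_prop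

theorem dziobek_eq_eval (x : Fin 8 → ℝ) (m : ℝ) (v : Fin 8 → ℝ) :
    dziobek x m = fun i => (dziobekExpr i).eval (joint x m v) :=
  funext fun i => (eval_dziobekExpr x m v i).symm

theorem contDiff_dziobek {k : WithTop ℕ∞} :
    ContDiff ℝ k (fun p : (Fin 8 → ℝ) × ℝ => dziobek p.1 p.2) := by
  simp only [dziobek_eq_eval _ _ 0]
  exact contDiff_pi.2 fun i => (dziobekExpr i).contDiff_eval.comp (contDiff_joint 0)

theorem hasFDerivAt_dziobek (x : Fin 8 → ℝ) (m : ℝ) (v : Fin 8 → ℝ) :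
    HasFDerivAt (fun y => dziobek y m) (ContinuousLinearMap.pi fun i =>
      ∑ j : Fin 8, ((dziobekExpr i).diff (j.castLE (by norm_num))).eval (joint x m v) •
        ContinuousLinearMap.proj (R := ℝ) (φ := fun _ => ℝ) j) x := by
  simp only [dziobek_eq_eval _ _ v]
  exact hasFDerivAt_pi.2 fun i => hasFDerivAt_eval_joint _ x m v

theorem jacobian_dziobek_apply (x : Fin 8 → ℝ) (m : ℝ) (v : Fin 8 → ℝ) (i j : Fin 8) :
    jacobian dziobek x m i j =
      ((dziobekExpr i).diff (j.castLE (by norm_num))).eval (joint x m v) := by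
  rw [jacobian, (hasFDerivAt_dziobek x m v).fderiv, LinearMap.toMatrix'_apply]
  simp [Pi.single_apply]

theorem jacobian_mulVec (x : Fin 8 → ℝ) (m : ℝ) (u : Fin 8 → ℝ) :
    (jacobian dziobek x m).mulVec u = fderiv ℝ (fun y => dziobek y m) x u := by
  rw [jacobian, ← Matrix.toLin'_apply, Matrix.toLin'_toMatrix']
  rfl

theorem fderiv_dziobek_apply (x : Fin 8 → ℝ) (m : ℝ) (v : Fin 8 → ℝ) (i : Fin 8) :
    fderiv ℝ (fun y => dziobek y m) x v i = (dirDeriv (dziobekExpr i)).eval (joint x m v) := by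
  rw [(hasFDerivAt_dziobek x m v).fderiv, eval_dirDeriv]
  simp

/-- `dirDeriv` differentiates only in the variables 0 to 7, so the entries of `v`, variables 9 to
16, stay constant in the second application. -/
theorem fderiv_fderiv_dziobek_apply (x : Fin 8 → ℝ) (m : ℝ) (v : Fin 8 → ℝ) (i : Fin 8) :
    fderiv ℝ (fderiv ℝ (fun y => dziobek y m)) x v v i =
      (dirDeriv (dirDeriv (dziobekExpr i))).eval (joint x m v) := by
  have hc : ContDiff ℝ 2 (fun y => dziobek y m) :=
    ContDiff.comp (g := fun p : (Fin 8 → ℝ) × ℝ => dziobek p.1 p.2) (f := fun y => (y, m))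
      contDiff_dziobek (contDiff_id.prodMk contDiff_const)
  have hd : DifferentiableAt ℝ (fderiv ℝ (fun y => dziobek y m)) x :=
    (hc.fderiv_right (m := 1) (by norm_num)).differentiable (by norm_num) x
  have h1 : HasFDerivAt (fun y => fderiv ℝ (fun y => dziobek y m) y v)
      ((fderiv ℝ (fderiv ℝ (fun y => dziobek y m)) x).flip v) x := by
    simpa using hd.hasFDerivAt.clm_apply (hasFDerivAt_const v x)
  have h2 : HasFDerivAt (fun y => fderiv ℝ (fun y => dziobek y m) y v i) _ x :=
    (hasFDerivAt_pi'.1 h1) i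
  simp only [fderiv_dziobek_apply] at h2
  have h3 := congrArg (fun L => L v) (h2.unique (hasFDerivAt_eval_joint _ x m v))
  rw [eval_dirDeriv]
  simpa using h3

theorem deriv_dziobek_mass_apply (x : Fin 8 → ℝ) (m : ℝ) (v : Fin 8 → ℝ) (i : Fin 8) :
    deriv (fun t => dziobek x t) m i = ((dziobekExpr i).diff 8).eval (joint x m v) := by
  have : HasDerivAt (fun t => dziobek x t)
      (fun i => ((dziobekExpr i).diff 8).eval (joint x m v)) m := by
    simp only [dziobek_eq_eval _ _ v]
    exact hasDerivAt_pi.2 fun i => hasDerivAt_eval_joint_mass _ x m v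
  rw [this.deriv]

/-- The singular zeros of the Dziobek map are the zeros of `singularExpr`. -/
theorem eval_singularExpr_joint_eq_zero_iff (x : Fin 8 → ℝ) (m : ℝ) (v : Fin 8 → ℝ) :
    (fun i => (singularExpr i).eval (joint x m v)) = 0 ↔
      dziobek x m = 0 ∧ (jacobian dziobek x m).mulVec v = 0 ∧ v 7 = 1 := by
  have h16 : joint x m v 16 = v 7 := rfl
  simp [funext_iff, Fin.forall_fin_succ, jacobian_mulVec, fderiv_dziobek_apply,
    ← eval_dziobekExpr x m v, singularExpr, sub_eq_zero, h16, and_assoc]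

theorem hasFDerivAt_eval_pi {n : ℕ} (g : Fin n → PolyExpr n) (z : Fin n → ℝ) :
    HasFDerivAt (fun y i => (g i).eval y)
      (Matrix.mulVecLin (Matrix.of fun i j => ((g i).diff j).eval z)).toContinuousLinearMap z := by
  refine hasFDerivAt_pi'.2 fun i => ((g i).hasFDerivAt_eval z).congr_fderiv ?_
  ext h
  simp [Matrix.mulVec, dotProduct]

/-! ### Fold bifurcations from a simple kernel. -/

section Fold

open Filter Set

/-- A function with a nondegenerate minimum at `0` is strictly monotone on both sides of `0`. -/
theorem exists_strictMonoOn_of_deriv_deriv_pos {g : ℝ → ℝ} (hc : ∀ᶠ s in 𝓝 0, ContinuousAt g s)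
    (h1 : deriv g 0 = 0) (h2 : 0 < deriv (deriv g) 0) :
    ∃ η > 0, ContinuousOn g (Icc (-η) η) ∧ StrictMonoOn g (Icc 0 η) ∧
      StrictAntiOn g (Icc (-η) 0) := by
  -- Near `0` the derivative of `g` has the sign of its argument.
  have hs := eventually_nhdsWithin_sign_eq_of_deriv_pos h2 h1
  obtain ⟨δ, hδ, h⟩ := Metric.eventually_nhds_iff.1 (hc.and hs)
  have hmem : ∀ s ∈ Icc (-(δ / 2)) (δ / 2), dist s 0 < δ := by
    intro s hs
    rw [Real.dist_0_eq_abs, abs_lt]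
    constructor <;> linarith [hs.1, hs.2]
  have hcont : ContinuousOn g (Icc (-(δ / 2)) (δ / 2)) := fun s hs =>
    (h (hmem s hs)).1.continuousWithinAt
  refine ⟨δ / 2, by positivity, hcont, ?_, ?_⟩
  · refine strictMonoOn_of_deriv_pos (convex_Icc _ _)
      (hcont.mono (Icc_subset_Icc_left (by linarith))) fun s hs => ?_
    rw [interior_Icc] at hs
    have := (h (hmem s ⟨by linarith [hs.1], hs.2.le⟩)).2
    rw [sub_zero, sign_pos hs.1] at this
    exact sign_eq_one_iff.1 this
  · refine strictAntiOn_of_deriv_neg (convex_Icc _ _)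
      (hcont.mono (Icc_subset_Icc_right (by linarith))) fun s hs => ?_
    rw [interior_Icc] at hs
    have := (h (hmem s ⟨hs.1.le, by linarith [hs.2]⟩)).2
    rw [sub_zero, sign_neg hs.2] at this
    exact sign_eq_neg_one_iff.1 this

variable {E : Type*} [NormedAddCommGroup E] [NormedSpace ℝ E]
  {F : E → ℝ → E} {x₀ v : E} {m₀ : ℝ} {ℓ φ : E →L[ℝ] ℝ}

theorem differentiableAt_deriv_of_contDiffAt {f : ℝ → E} {s : ℝ} (hf : ContDiffAt ℝ 2 f s) :
    DifferentiableAt ℝ (deriv f) s := by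
  have h : DifferentiableAt ℝ (fderiv ℝ f) s :=
    (hf.fderiv_right (m := 1) (by norm_num)).differentiableAt (by norm_num)
  exact h.clm_apply (differentiableAt_const 1)

theorem fderiv_apply_left (hF : Differentiable ℝ (fun p : E × ℝ => F p.1 p.2)) (x : E) (m : ℝ) :
    fderiv ℝ (fun y => F y m) x =
      (fderiv ℝ (fun p : E × ℝ => F p.1 p.2) (x, m)).comp (ContinuousLinearMap.inl ℝ E ℝ) :=
  (HasFDerivAt.comp (g := fun p : E × ℝ => F p.1 p.2) (f := fun y => (y, m)) x
    (hF (x, m)).hasFDerivAt (hasFDerivAt_prodMk_left x m)).fderiv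

theorem deriv_apply_right (hF : Differentiable ℝ (fun p : E × ℝ => F p.1 p.2)) (x : E) (m : ℝ) :
    deriv (fun t => F x t) m = fderiv ℝ (fun p : E × ℝ => F p.1 p.2) (x, m) (0, 1) :=
  ((hF (x, m)).hasFDerivAt.comp_hasDerivAt m
    ((hasDerivAt_const m x).prodMk (hasDerivAt_id m))).deriv

/-- The chart and the chain rule use the total derivative, while the fold conditions concern partial
derivatives. -/
theorem fderiv_apply_prod (hF : Differentiable ℝ (fun p : E × ℝ => F p.1 p.2)) (x u : E)
    (m k : ℝ) :
    fderiv ℝ (fun p : E × ℝ => F p.1 p.2) (x, m) (u, k) =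
      fderiv ℝ (fun y => F y m) x u + k • deriv (fun t => F x t) m := by
  rw [fderiv_apply_left hF, deriv_apply_right hF, ContinuousLinearMap.comp_apply,
    ContinuousLinearMap.inl_apply, ← map_smul, ← map_add]
  simp

theorem fderiv_fderiv_apply_left (hF : ContDiff ℝ 2 (fun p : E × ℝ => F p.1 p.2)) (x u : E)
    (m : ℝ) :
    fderiv ℝ (fderiv ℝ (fun y => F y m)) x u u =
      fderiv ℝ (fderiv ℝ (fun p : E × ℝ => F p.1 p.2)) (x, m) (u, 0) (u, 0) := by
  have hd : Differentiable ℝ (fun p : E × ℝ => F p.1 p.2) := hF.differentiable (by norm_num)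
  have hT : Differentiable ℝ (fderiv ℝ (fun p : E × ℝ => F p.1 p.2)) :=
    (hF.fderiv_right (m := 1) (by norm_num)).differentiable (by norm_num)
  have h1 : fderiv ℝ (fun y => F y m) = fun y =>
      (fderiv ℝ (fun p : E × ℝ => F p.1 p.2) (y, m)).comp (ContinuousLinearMap.inl ℝ E ℝ) :=
    funext fun y => fderiv_apply_left hd y m
  have h2 := (HasFDerivAt.comp (g := fderiv ℝ (fun p : E × ℝ => F p.1 p.2))
    (f := fun y => (y, m)) x (hT (x, m)).hasFDerivAt (hasFDerivAt_prodMk_left x m)).clm_comp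
    (hasFDerivAt_const (ContinuousLinearMap.inl ℝ E ℝ) x)
  rw [h1]
  erw [h2.fderiv]
  simp

/-- The derivatives at the fold point of a curve of zeros that is parametrized by `ℓ`. -/
theorem fold_curve_derivs (hF : ContDiff ℝ ω (fun p : E × ℝ => F p.1 p.2))
    (hker : ∀ u, fderiv ℝ (fun y => F y m₀) x₀ u = 0 → u = ℓ u • v)
    (hφ : ∀ u, φ (fderiv ℝ (fun y => F y m₀) x₀ u) = 0)
    (ha : φ (deriv (fun t => F x₀ t) m₀) ≠ 0) {γ : ℝ → E} {μ : ℝ → ℝ}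
    (hγ : ContDiffAt ℝ ω γ 0) (hμ : ContDiffAt ℝ ω μ 0) (hγ0 : γ 0 = x₀) (hμ0 : μ 0 = m₀)
    (hz : ∀ᶠ s in 𝓝 0, F (γ s) (μ s) = 0) (hl : ∀ᶠ s in 𝓝 0, ℓ (γ s - x₀) = s) :
    deriv γ 0 = v ∧ deriv μ 0 = 0 ∧ deriv (deriv μ) 0 =
      -φ (fderiv ℝ (fderiv ℝ (fun y => F y m₀)) x₀ v v) / φ (deriv (fun t => F x₀ t) m₀) := by
  have hd : Differentiable ℝ (fun p : E × ℝ => F p.1 p.2) := hF.differentiable (by norm_num)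
  have hF2 : ContDiff ℝ 2 (fun p : E × ℝ => F p.1 p.2) := hF.of_le le_top
  have hT : Differentiable ℝ (fderiv ℝ (fun p : E × ℝ => F p.1 p.2)) :=
    (hF2.fderiv_right (m := 1) (by norm_num)).differentiable (by norm_num)
  have hdγ := hγ.differentiableAt (by norm_num)
  have hdμ := hμ.differentiableAt (by norm_num)
  -- The differentiated equation is kept on a neighbourhood, so that it can be differentiated again.
  have hev : ∀ᶠ s in 𝓝 0, fderiv ℝ (fun p : E × ℝ => F p.1 p.2) (γ s, μ s)
      (deriv γ s, deriv μ s) = 0 := by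
    filter_upwards [hz.eventually_nhds, hγ.eventually (by decide), hμ.eventually (by decide)]
      with s hzs hγs hμs
    have h1 := (hd (γ s, μ s)).hasFDerivAt.comp_hasDerivAt s
      ((hγs.differentiableAt (by norm_num)).hasDerivAt.prodMk
        (hμs.differentiableAt (by norm_num)).hasDerivAt)
    rw [← h1.deriv]
    refine (EventuallyEq.deriv_eq ?_).trans (deriv_const s (0 : E))
    exact hzs
  have h0 := hev.self_of_nhds
  rw [hγ0, hμ0, fderiv_apply_prod hd] at h0
  -- `φ` annihilates the range of the `x`-derivative, which leaves `μ'(0) φ(F_m) = 0`.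
  have hμ' : deriv μ 0 = 0 := by
    have := congrArg φ h0
    rw [map_add, hφ, map_smul, map_zero, zero_add, smul_eq_mul] at this
    exact (mul_eq_zero.1 this).resolve_right ha
  have hℓ' : ℓ (deriv γ 0) = 1 := by
    have h1 := ℓ.hasFDerivAt.comp_hasDerivAt 0 (hdγ.hasDerivAt.sub_const x₀)
    rw [← h1.deriv]
    refine (EventuallyEq.deriv_eq ?_).trans (deriv_id (0 : ℝ))
    exact hl
  have hγ' : deriv γ 0 = v := by
    rw [hμ', zero_smul, add_zero] at h0
    have := hker _ h0
    rwa [hℓ', one_smul] at this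
  refine ⟨hγ', hμ', ?_⟩
  have hd2γ : DifferentiableAt ℝ (deriv γ) 0 :=
    differentiableAt_deriv_of_contDiffAt (hγ.of_le le_top)
  have hd2μ : DifferentiableAt ℝ (deriv μ) 0 :=
    differentiableAt_deriv_of_contDiffAt (hμ.of_le le_top)
  have hT' := (hT (γ 0, μ 0)).hasFDerivAt.comp_hasDerivAt (0 : ℝ)
    (hdγ.hasDerivAt.prodMk hdμ.hasDerivAt)
  have h3 := hT'.clm_apply (hd2γ.hasDerivAt.prodMk hd2μ.hasDerivAt)
  have h4 : deriv (fun s => fderiv ℝ (fun p : E × ℝ => F p.1 p.2) (γ s, μ s)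
      (deriv γ s, deriv μ s)) 0 = 0 :=
    (EventuallyEq.deriv_eq hev).trans (deriv_const (0 : ℝ) (0 : E))
  erw [h3.deriv] at h4
  -- Because `μ'(0) = 0`, no mixed second derivatives occur, and `φ` removes the term with `γ''(0)`.
  have h5 := congrArg φ h4
  simp only [hγ0, hμ0, hγ', hμ', Function.comp] at h5
  rw [map_add, fderiv_apply_prod hd, map_add, hφ, map_smul, map_zero, zero_add, smul_eq_mul,
    ← fderiv_fderiv_apply_left hF2] at h5
  rw [eq_div_iff ha]
  linarith

/-- Coordinates `(F, ℓ)` near a fold point. -/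
theorem exists_fold_chart [FiniteDimensional ℝ E]
    (hF : ContDiff ℝ ω (fun p : E × ℝ => F p.1 p.2)) (hF0 : F x₀ m₀ = 0)
    (hker : ∀ u, fderiv ℝ (fun y => F y m₀) x₀ u = 0 → u = ℓ u • v)
    (hφ : ∀ u, φ (fderiv ℝ (fun y => F y m₀) x₀ u) = 0)
    (ha : φ (deriv (fun t => F x₀ t) m₀) ≠ 0) :
    ∃ P : OpenPartialHomeomorph (E × ℝ) (E × ℝ), (∀ p, P p = (F p.1 p.2, ℓ (p.1 - x₀))) ∧
      (x₀, m₀) ∈ P.source ∧ P.symm (0, 0) = (x₀, m₀) ∧ ContDiffAt ℝ ω P.symm (0, 0) := by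
  have hd : Differentiable ℝ (fun p : E × ℝ => F p.1 p.2) := hF.differentiable (by norm_num)
  let Φ : E × ℝ → E × ℝ := fun p => (F p.1 p.2, ℓ (p.1 - x₀))
  have hΦ : ContDiff ℝ ω Φ := hF.prodMk (ℓ.contDiff.comp (contDiff_fst.sub contDiff_const))
  let A : E × ℝ →L[ℝ] E × ℝ := (fderiv ℝ (fun p : E × ℝ => F p.1 p.2) (x₀, m₀)).prod
    (ℓ.comp (ContinuousLinearMap.fst ℝ E ℝ))
  have hA : HasFDerivAt Φ A (x₀, m₀) :=
    (hd (x₀, m₀)).hasFDerivAt.prodMk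
      (ℓ.hasFDerivAt.comp (x₀, m₀) (hasFDerivAt_fst.sub_const x₀))
  -- For `(u, k)` in the kernel, `φ` forces `k = 0`; then `u` is a multiple of `v`, and `ℓ u = 0`
  -- makes it zero. In finite dimension injectivity suffices for the inverse function theorem.
  have hinj : Function.Injective A := by
    rw [injective_iff_map_eq_zero]
    rintro ⟨u, k⟩ huk
    have h1 : fderiv ℝ (fun p : E × ℝ => F p.1 p.2) (x₀, m₀) (u, k) = 0 := congrArg Prod.fst huk
    have h2 : ℓ u = 0 := congrArg Prod.snd huk
    rw [fderiv_apply_prod hd] at h1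
    have hk : k = 0 := by
      have := congrArg φ h1
      rw [map_add, hφ, map_smul, map_zero, zero_add, smul_eq_mul] at this
      exact (mul_eq_zero.1 this).resolve_right ha
    rw [hk, zero_smul, add_zero] at h1
    have hu := hker u h1
    rw [h2, zero_smul] at hu
    rw [hu, hk]
    rfl
  let e : (E × ℝ) ≃L[ℝ] (E × ℝ) :=
    (LinearEquiv.ofInjectiveEndo (A : E × ℝ →ₗ[ℝ] E × ℝ) hinj).toContinuousLinearEquiv
  have he : HasFDerivAt Φ (e : E × ℝ →L[ℝ] E × ℝ) (x₀, m₀) := hA.congr_fderiv (by ext <;> rfl)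
  have hΦ0 : Φ (x₀, m₀) = (0, 0) := by simp [Φ, hF0]
  have : CompleteSpace E := FiniteDimensional.complete ℝ E
  have hn : (ω : WithTop ℕ∞) ≠ 0 := by decide
  refine ⟨hΦ.contDiffAt.toOpenPartialHomeomorph Φ he hn, fun p => rfl,
    hΦ.contDiffAt.mem_toOpenPartialHomeomorph_source he hn, ?_, ?_⟩
  · rw [← hΦ0]
    exact hΦ.contDiffAt.localInverse_apply_image he hn
  · rw [← hΦ0]
    exact hΦ.contDiffAt.to_localInverse he hn

/-- A zero with a simple kernel, transversality and a nondegenerate quadratic term is a fold. -/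
theorem isFoldBifurcation_of_simple_kernel [FiniteDimensional ℝ E]
    (hF : ContDiff ℝ ω (fun p : E × ℝ => F p.1 p.2)) (hF0 : F x₀ m₀ = 0) (hℓ : ℓ v = 1)
    (hker : ∀ u, fderiv ℝ (fun y => F y m₀) x₀ u = 0 → u = ℓ u • v)
    (hφ : ∀ u, φ (fderiv ℝ (fun y => F y m₀) x₀ u) = 0)
    (ha : φ (deriv (fun t => F x₀ t) m₀) ≠ 0) {σ : ℝ}
    (hσ : 0 < σ * (-φ (fderiv ℝ (fderiv ℝ (fun y => F y m₀)) x₀ v v) /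
      φ (deriv (fun t => F x₀ t) m₀))) :
    IsFoldBifurcation F x₀ m₀ σ := by
  obtain ⟨P, hP, hPs, hP0, hPc⟩ := exists_fold_chart hF hF0 hker hφ ha
  have hσ0 : σ ≠ 0 := by
    rintro rfl
    simp at hσ
  -- The curve is the preimage of the line `F = 0` under the chart, so its parameter is `ℓ (x -
  -- x₀)`.
  set γ : ℝ → E := fun s => (P.symm (0, s)).1 with hγdef
  set μ : ℝ → ℝ := fun s => (P.symm (0, s)).2 with hμdef
  have hψ : ContDiffAt ℝ ω (fun s : ℝ => P.symm ((0 : E), s)) 0 :=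
    ContDiffAt.comp (g := P.symm) (f := fun s : ℝ => ((0 : E), s)) 0 hPc
      (contDiffAt_const.prodMk contDiffAt_id)
  have hγ : ContDiffAt ℝ ω γ 0 := hψ.fst
  have hμ : ContDiffAt ℝ ω μ 0 := hψ.snd
  have hγ0 : γ 0 = x₀ := congrArg Prod.fst hP0
  have hμ0 : μ 0 = m₀ := congrArg Prod.snd hP0
  have htarget : ∀ᶠ s : ℝ in 𝓝 0, ((0 : E), s) ∈ P.target := by
    have h0 : ((0 : E), (0 : ℝ)) ∈ P.target := by
      have := P.map_source hPs
      rw [hP] at this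
      simpa [hF0] using this
    have hcont : ContinuousAt (fun s : ℝ => ((0 : E), s)) 0 := by fun_prop
    exact hcont (P.open_target.mem_nhds h0)
  have hcurve : ∀ s, ((0 : E), s) ∈ P.target → F (γ s) (μ s) = 0 ∧ ℓ (γ s - x₀) = s := by
    intro s hs
    have := P.right_inv hs
    rw [hP] at this
    exact ⟨congrArg Prod.fst this, congrArg Prod.snd this⟩
  have hzero : ∀ x m, (x, m) ∈ P.source → F x m = 0 →
      γ (ℓ (x - x₀)) = x ∧ μ (ℓ (x - x₀)) = m := by
    intro x m hxm hx
    have := P.left_inv hxm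
    rw [hP] at this
    simp only [hx] at this
    exact ⟨congrArg Prod.fst this, congrArg Prod.snd this⟩
  obtain ⟨hγ', hμ', hμ''⟩ := fold_curve_derivs hF hker hφ ha hγ hμ hγ0 hμ0
    (htarget.mono fun s hs => (hcurve s hs).1) (htarget.mono fun s hs => (hcurve s hs).2)
  rw [← hμ''] at hσ
  -- Analyticity at a point persists nearby; `ContDiffAt` of order `∞` would not directly yield one
  -- common neighbourhood for all orders.
  obtain ⟨δ, hδ, hδP⟩ := Metric.eventually_nhds_iff.1
    (htarget.and ((hγ.eventually (by decide)).and (hμ.eventually (by decide))))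
  have hIoo : ∀ s ∈ Ioo (-δ) δ, dist s 0 < δ := by
    intro s hs
    rw [Real.dist_0_eq_abs]
    exact abs_lt.2 hs
  refine ⟨⟨γ, μ, δ, hδ, ?_, ?_, ?_, hγ0, hμ0, ?_, hμ', hσ, ?_⟩, ?_⟩
  · exact fun s hs => ((hδP (hIoo s hs)).2.1.of_le le_top).contDiffWithinAt
  · exact fun s hs => ((hδP (hIoo s hs)).2.2.of_le le_top).contDiffWithinAt
  · intro s hs t ht hst
    rw [← (hcurve s (hδP (hIoo s hs)).1).2, ← (hcurve t (hδP (hIoo t ht)).1).2, hst]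
  · rw [hγ']
    rintro rfl
    simp at hℓ
  · refine ⟨P.source ∩ {p | |ℓ (p.1 - x₀)| < δ}, ?_, ?_⟩
    · refine (P.open_source.inter (isOpen_lt (by fun_prop) continuous_const)).mem_nhds ⟨hPs, ?_⟩
      simpa using hδ
    · ext ⟨x, m⟩
      constructor
      · rintro ⟨⟨hs, hl⟩, hx⟩
        obtain ⟨h1, h2⟩ := hzero x m hs hx
        exact ⟨ℓ (x - x₀), abs_lt.1 hl, Prod.ext h1 h2⟩
      · rintro ⟨s, hs, hsx⟩
        have ht := (hδP (hIoo s hs)).1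
        rw [← hsx]
        refine ⟨⟨P.map_target ht, ?_⟩, (hcurve s ht).1⟩
        simp only [mem_ofPred_eq]
        rw [(hcurve s ht).2]
        exact abs_lt.2 hs
  · intro W hW
    -- The factor `σ` turns the turning point into a strict minimum of `g` with value `0`, whatever
    -- the side of the solutions.
    set g : ℝ → ℝ := fun s => σ * (μ s - m₀) with hg
    have hdg : deriv g = fun s => σ * deriv μ s := by
      funext s
      simp [hg]
    obtain ⟨η₁, hη₁, hgc, hgm, hga⟩ := exists_strictMonoOn_of_deriv_deriv_pos (g := g)
      ((hμ.eventually (by decide)).mono fun s hs =>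
        (hs.continuousAt.sub continuousAt_const).const_mul σ)
      (by rw [hdg]; simp [hμ']) (by rw [hdg]; simpa using hσ)
    have hg0 : g 0 = 0 := by simp [hg, hμ0]
    obtain ⟨O, hO, V, hV, hOV⟩ := mem_nhds_prod_iff.1 (P.open_source.mem_nhds hPs)
    obtain ⟨ε₀, hε₀, hVε⟩ := Metric.mem_nhds_iff.1 hV
    obtain ⟨η₂, hη₂, hγO⟩ := Metric.eventually_nhds_iff.1
      (hγ.continuousAt.eventually_mem (show O ∩ W ∈ 𝓝 (γ 0) by rw [hγ0]; exact inter_mem hO hW))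
    -- `η₁` provides monotonicity on both sides, `η₂` keeps the curve in `O ∩ W`, and `δ` stays in
    -- the chart.
    set η := min (min η₁ η₂) δ with hη
    have hηpos : 0 < η := by positivity
    have hle1 : η ≤ η₁ := (min_le_left _ _).trans (min_le_left _ _)
    have hle2 : η ≤ η₂ := (min_le_left _ _).trans (min_le_right _ _)
    have hle3 : η ≤ δ := min_le_right _ _
    have hgm' : StrictMonoOn g (Icc 0 η) := hgm.mono (Icc_subset_Icc_right hle1)
    have hga' : StrictAntiOn g (Icc (-η) 0) := hga.mono (Icc_subset_Icc_left (by linarith))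
    have hcr : ContinuousOn g (Icc 0 η) := hgc.mono (Icc_subset_Icc (by linarith) hle1)
    have hcl : ContinuousOn g (Icc (-η) 0) := hgc.mono (Icc_subset_Icc (by linarith) hη₁.le)
    have hgr : 0 < g η := by
      rw [← hg0]
      exact hgm' ⟨le_rfl, hηpos.le⟩ ⟨hηpos.le, le_rfl⟩ hηpos
    have hgl : 0 < g (-η) := by
      rw [← hg0]
      exact hga' ⟨le_rfl, by linarith⟩ ⟨by linarith, le_rfl⟩ (by linarith)
    have hpos : ∀ s, |s| < η → s ≠ 0 → 0 < g s := by
      intro s hs hs0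
      obtain ⟨h1, h2⟩ := abs_lt.1 hs
      rw [← hg0]
      rcases lt_or_gt_of_ne hs0 with h | h
      · exact hga' ⟨h1.le, h.le⟩ ⟨by linarith, le_rfl⟩ h
      · exact hgm' ⟨le_rfl, hηpos.le⟩ ⟨h.le, h2.le⟩ h
    refine ⟨(O ∩ W) ∩ {x | |ℓ (x - x₀)| < η}, ?_, fun x hx => hx.1.2, ?_⟩
    · refine inter_mem (inter_mem hO hW)
        ((isOpen_lt (by fun_prop) continuous_const).mem_nhds ?_)
      simpa using hηpos
    set U := (O ∩ W) ∩ {x | |ℓ (x - x₀)| < η} with hU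
    -- Counting solutions at the parameter `m` becomes counting points of a level set of `g`.
    have hsol : ∀ m, |m - m₀| < ε₀ → {x | x ∈ U ∧ F x m = 0} =
        γ '' {s | |s| < η ∧ g s = σ * (m - m₀)} := by
      intro m hm
      ext x
      constructor
      · rintro ⟨⟨⟨hxO, -⟩, hl⟩, hx⟩
        have hs : (x, m) ∈ P.source :=
          hOV ⟨hxO, hVε (by simpa [Real.dist_eq] using hm)⟩
        obtain ⟨h1, h2⟩ := hzero x m hs hx
        exact ⟨ℓ (x - x₀), ⟨hl, by simp only [hg, h2]⟩, h1⟩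
      · rintro ⟨s, ⟨hs, hgs⟩, rfl⟩
        have hμs : μ s = m := by
          have := mul_left_cancel₀ hσ0 hgs
          linarith
        obtain ⟨h1, h2⟩ := hcurve s
          (hδP (by rw [Real.dist_0_eq_abs]; exact hs.trans_le hle3)).1
        refine ⟨⟨hγO (by rw [Real.dist_0_eq_abs]; exact hs.trans_le hle2), ?_⟩, hμs ▸ h1⟩
        change |ℓ (γ s - x₀)| < η
        rwa [h2]
    -- Levels below `g η` and `g (-η)` are attained on both sides of `0` if positive, by the
    -- intermediate value theorem.
    refine ⟨min ε₀ (min (g η) (g (-η)) / |σ|), by positivity, fun m hm => ?_⟩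
    have hm1 : |m - m₀| < ε₀ := hm.trans_le (min_le_left _ _)
    have hm2 : σ * (m - m₀) < min (g η) (g (-η)) := by
      have h1 := hm.trans_le (min_le_right _ _)
      rw [lt_div_iff₀ (by positivity), mul_comm, ← abs_mul] at h1
      exact (le_abs_self _).trans_lt h1
    rw [hsol m hm1]
    refine ⟨fun h => ?_, fun h => ?_, fun h => ?_⟩
    · obtain ⟨s, hs, hgs⟩ := intermediate_value_Ioo hηpos.le hcr
        ⟨by rw [hg0]; exact h, hm2.trans_le (min_le_left _ _)⟩
      obtain ⟨t, ht, hgt⟩ := intermediate_value_Ioo' (by linarith : -η ≤ 0) hcl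
        ⟨by rw [hg0]; exact h, hm2.trans_le (min_le_right _ _)⟩
      have hset : {s | |s| < η ∧ g s = σ * (m - m₀)} = {s, t} := by
        ext r
        simp only [mem_ofPred_eq, mem_insert_iff, mem_singleton_iff]
        constructor
        · rintro ⟨hr, hgr⟩
          obtain ⟨h1, h2⟩ := abs_lt.1 hr
          rcases le_total 0 r with h0 | h0
          · exact Or.inl (hgm'.injOn ⟨h0, h2.le⟩ ⟨hs.1.le, hs.2.le⟩ (hgr.trans hgs.symm))
          · exact Or.inr (hga'.injOn ⟨h1.le, h0⟩ ⟨ht.1.le, ht.2.le⟩ (hgr.trans hgt.symm))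
        · rintro (rfl | rfl)
          · exact ⟨abs_lt.2 ⟨by linarith [hs.1], hs.2⟩, hgs⟩
          · exact ⟨abs_lt.2 ⟨ht.1, by linarith [ht.2]⟩, hgt⟩
      rw [hset, image_pair]
      refine ncard_pair fun hst => ?_
      have h1 := (hcurve s (hδP (hIoo s ⟨by linarith [hs.1], by linarith [hs.2]⟩)).1).2
      have h2 := (hcurve t (hδP (hIoo t ⟨by linarith [ht.1], by linarith [ht.2]⟩)).1).2
      rw [hst, h2] at h1
      linarith [hs.1, ht.2]
    · have hset : {s | |s| < η ∧ g s = σ * (m - m₀)} = {0} := by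
        ext r
        simp only [mem_ofPred_eq, mem_singleton_iff, h, sub_self, mul_zero]
        constructor
        · rintro ⟨hr, hgr⟩
          by_contra h0
          exact (hpos r hr h0).ne' hgr
        · rintro rfl
          exact ⟨by simpa using hηpos, hg0⟩
      rw [hset, image_singleton, hγ0]
    · have hset : {s | |s| < η ∧ g s = σ * (m - m₀)} = ∅ := by
        ext r
        simp only [mem_ofPred_eq, mem_empty_iff_false, iff_false, not_and]
        intro hr hgr
        rcases eq_or_ne r 0 with rfl | h0
        · linarith
        · linarith [hpos r hr h0]
      rw [hset, image_empty]

end Fold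

/-! ### Kites as central configurations. -/

section Kite

/-- The kite with the vertices `(-p, 0)`, `(p, 0)`, `(0, y)`, `(0, z)`. -/
def kite (p y z : ℝ) : Fin 4 → EuclideanSpace ℝ (Fin 2) :=
  ![!₂[-p, 0], !₂[p, 0], !₂[0, y], !₂[0, z]]

/-- The points whose three barycentric coordinates with respect to the triangle are positive form an
open subset `O` of it. -/
theorem kite_third_mem_interior {p y z : ℝ} (hp : 0 < p) (hy : 0 < y) (hyz : y < z) :
    kite p y z 2 ∈ interior (convexHull ℝ {kite p y z 0, kite p y z 1, kite p y z 3}) := by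
  have hz : 0 < z := hy.trans hyz
  let O : Set (EuclideanSpace ℝ (Fin 2)) := {u | 0 < u 1 / z} ∩
    ({u | 0 < (1 - u 1 / z + u 0 / p) / 2} ∩ {u | 0 < (1 - u 1 / z - u 0 / p) / 2})
  have hO : IsOpen O := by
    refine (isOpen_lt continuous_const ?_).inter
      ((isOpen_lt continuous_const ?_).inter (isOpen_lt continuous_const ?_)) <;> fun_prop
  refine interior_maximal ?_ hO ?_
  · rintro u ⟨h3, h2, h1⟩
    have h3' : 0 < u 1 / z := h3
    have h2' : 0 < (1 - u 1 / z + u 0 / p) / 2 := h2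
    have h1' : 0 < (1 - u 1 / z - u 0 / p) / 2 := h1
    have hu : u = ((1 - u 1 / z - u 0 / p) / 2) • kite p y z 0 +
        ((1 - u 1 / z + u 0 / p) / 2) • kite p y z 1 + (u 1 / z) • kite p y z 3 := by
      ext i
      fin_cases i
      · simp [kite]
        field_simp
        ring
      · simp [kite]
        field_simp
    rw [hu]
    have hsum := (convex_convexHull ℝ {kite p y z 0, kite p y z 1, kite p y z 3}).sum_mem
      (t := Finset.univ) (w := ![(1 - u 1 / z - u 0 / p) / 2, (1 - u 1 / z + u 0 / p) / 2, u 1 / z])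
      (z := ![kite p y z 0, kite p y z 1, kite p y z 3])
    simp only [Finset.mem_univ, true_imp_iff, Fin.forall_fin_succ, Fin.sum_univ_three] at hsum
    refine hsum (by simp [h1'.le, h2'.le, h3'.le]) (by simp; ring) ?_
    refine ⟨subset_convexHull ℝ _ ?_, subset_convexHull ℝ _ ?_, subset_convexHull ℝ _ ?_, ?_⟩ <;>
      simp
  · have : y / z < 1 := (div_lt_one hz).2 hyz
    refine ⟨?_, ?_, ?_⟩ <;> simp [kite] <;> first | positivity | linarith

theorem kite_dist {p y z a b c d : ℝ} (ha : 0 ≤ a) (hb : 0 ≤ b) (hc : 0 ≤ c) (hd : 0 ≤ d)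
    (ha2 : a ^ 2 = 4 * p ^ 2) (hb2 : b ^ 2 = p ^ 2 + y ^ 2) (hc2 : c ^ 2 = p ^ 2 + z ^ 2)
    (hd2 : d ^ 2 = (z - y) ^ 2) {l m : ℝ} :
    HasMutualDistances (kite p y z) ![l, m, a, b, c, b, c, d] := by
  refine ⟨?_, ?_, ?_, ?_, ?_, ?_⟩ <;>
    rw [EuclideanSpace.dist_eq, Real.sqrt_eq_iff_mul_self_eq] <;>
    simp [kite, Fin.sum_univ_two, Real.dist_eq] <;> first | assumption | nlinarith

/-- Here `d` is still free: the last factor is `(d² - (z - y)²) ((y + z)² - d²)`, so planarity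
leaves two candidates for `d²`. -/
theorem cayleyMenger_kite {l m p y z a b c d : ℝ}
    (ha2 : a ^ 2 = 4 * p ^ 2) (hb2 : b ^ 2 = p ^ 2 + y ^ 2) (hc2 : c ^ 2 = p ^ 2 + z ^ 2) :
    cayleyMenger ![l, m, a, b, c, b, c, d] =
      8 * p ^ 2 * (4 * y ^ 2 * z ^ 2 - (y ^ 2 + z ^ 2 - d ^ 2) ^ 2) := by
  rw [cayleyMenger_eq]
  simp [ha2, hb2, hc2]
  ring

/-- The Dziobek equations give `rᵢⱼ⁻³ = 2l / M + 4μ sᵢⱼ / (mᵢ mⱼ)`, with `sᵢⱼ` the value of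
`sPartial`. For the kite `sᵢⱼ = -4p² Δᵢ Δⱼ` with `Δ = (z - y, z - y, -2z, 2y)`, and `∑ Δᵢ = 0`, `∑
Δᵢ qᵢ = 0`. Hence the terms with `μ` cancel in the force on each body, and the first term yields the
factor `-2 * l`. -/
theorem isCentralConfiguration_kite {l μ m p y z a b c d : ℝ} (ha : 0 < a) (hb : 0 < b)
    (hc : 0 < c) (hd : 0 < d) (hm : 0 < m)
    (ha2 : a ^ 2 = 4 * p ^ 2) (hb2 : b ^ 2 = p ^ 2 + y ^ 2) (hc2 : c ^ 2 = p ^ 2 + z ^ 2)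
    (hd2 : d ^ 2 = (z - y) ^ 2) (hF : dziobek ![l, μ, a, b, c, b, c, d] m = 0) :
    IsCentralConfiguration (mass m) (kite p y z) := by
  obtain ⟨h01, h02, h03, h12, h13, h23⟩ :=
    kite_dist ha.le hb.le hc.le hd.le ha2 hb2 hc2 hd2 (l := l) (m := μ)
  simp only [Matrix.cons_val] at h01 h02 h03 h12 h13 h23
  have hM : (3 + m) ≠ 0 := by positivity
  -- Here `k` stands for `mᵢ mⱼ`, which is `1` or `m`.
  have inverse_cube : ∀ {t k s : ℝ}, 0 < t → 0 < k →
      -(3 + m) * k + 2 * l * k * t ^ 3 + 4 * (3 + m) * μ * t ^ 3 * s = 0 →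
      (t ^ 3)⁻¹ = (2 * l * k + 4 * (3 + m) * μ * s) / (k * (3 + m)) := by
    intro t k s ht hk h
    field_simp
    linear_combination -h
  have e12 := congrFun hF 2
  have e13 := congrFun hF 3
  have e14 := congrFun hF 4
  have e34 := congrFun hF 7
  simp only [dziobek, Matrix.cons_val, Pi.zero_apply, sPartial, ha2, hb2, hc2, hd2]
    at e12 e13 e14 e34
  have g12 := inverse_cube (s := -4 * p ^ 2 * (z - y) ^ 2) ha one_pos (by linear_combination e12)
  have g13 := inverse_cube (s := 8 * p ^ 2 * z * (z - y)) hb one_pos (by linear_combination e13)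
  have g14 := inverse_cube (s := -8 * p ^ 2 * y * (z - y)) hc hm (by linear_combination e14)
  have g34 := inverse_cube (s := 16 * p ^ 2 * y * z) hd hm (by linear_combination e34)
  refine ⟨?_, -2 * l, fun j => ?_⟩
  · intro i j hij
    have h : dist (kite p y z i) (kite p y z j) = 0 := by rw [hij, dist_self]
    fin_cases i <;> fin_cases j <;> first | rfl | skip
    all_goals
      exfalso
      simp only [Fin.mk_zero, Fin.mk_one, Fin.reduceFinMk] at h
      first
        | linarith
        | (rw [dist_comm] at h; linarith)
  · rw [Finset.sum_erase _ (by simp), Fin.sum_univ_four]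
    have hG : centerOfMass (mass m) (kite p y z) = !₂[0, (y + m * z) / (3 + m)] := by
      ext i
      fin_cases i <;> simp [centerOfMass, mass, kite, Fin.sum_univ_four]
      ring_nf
    rw [hG]
    have h10 : dist (kite p y z 1) (kite p y z 0) = a := by rw [dist_comm, h01]
    have h20 : dist (kite p y z 2) (kite p y z 0) = b := by rw [dist_comm, h02]
    have h30 : dist (kite p y z 3) (kite p y z 0) = c := by rw [dist_comm, h03]
    have h21 : dist (kite p y z 2) (kite p y z 1) = b := by rw [dist_comm, h12]
    have h31 : dist (kite p y z 3) (kite p y z 1) = c := by rw [dist_comm, h13]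
    have h32 : dist (kite p y z 3) (kite p y z 2) = d := by rw [dist_comm, h23]
    fin_cases j <;>
      simp only [Fin.mk_zero, Fin.mk_one, Fin.reduceFinMk, h01, h02, h03, h12, h13, h23, h10, h20,
        h30, h21, h31, h32, sub_self, smul_zero]
    all_goals
      ext i
      fin_cases i <;> simp [kite, mass]
    all_goals
      simp only [div_eq_mul_inv m, g12, g13, g14, g34]
      field_simp
      ring

/-- Symmetric zeros of the Dziobek map give kites that are central configurations. -/
theorem exists_central_kite {x : Fin 8 → ℝ} {m : ℝ} (hx : swap12 x = x) (hF : dziobek x m = 0)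
    (hm : 0 < m) (h2 : 0 < x 2) (h3 : 0 < x 3) (h34 : x 3 < x 4) (h7 : 0 < x 7)
    (h23 : x 2 ^ 2 < 4 * x 3 ^ 2) (h27 : x 2 ^ 2 / 2 + x 7 ^ 2 < x 3 ^ 2 + x 4 ^ 2) :
    ∃ q : Fin 4 → EuclideanSpace ℝ (Fin 2),
      HasMutualDistances q x ∧ IsCentralConfiguration (mass m) q ∧
        q 2 ∈ interior (convexHull ℝ {q 0, q 1, q 3}) := by
  have hx' : x = ![x 0, x 1, x 2, x 3, x 4, x 3, x 4, x 7] := by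
    have h5 : x 5 = x 3 := congrFun hx 3
    have h6 : x 6 = x 4 := congrFun hx 4
    conv_lhs => rw [← hx]
    simp only [swap12, h5, h6]
  obtain ⟨p, hp, ha2⟩ : ∃ p > 0, x 2 ^ 2 = 4 * p ^ 2 := ⟨x 2 / 2, by positivity, by ring⟩
  obtain ⟨y, hy, hb2⟩ : ∃ y > 0, x 3 ^ 2 = p ^ 2 + y ^ 2 := by
    have : 0 < x 3 ^ 2 - p ^ 2 := by linarith
    exact ⟨√(x 3 ^ 2 - p ^ 2), by positivity, by rw [Real.sq_sqrt this.le]; ring⟩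
  have h34' : x 3 ^ 2 < x 4 ^ 2 := by gcongr
  obtain ⟨z, hz, hc2⟩ : ∃ z > 0, x 4 ^ 2 = p ^ 2 + z ^ 2 := by
    have : 0 < x 4 ^ 2 - p ^ 2 := by nlinarith
    exact ⟨√(x 4 ^ 2 - p ^ 2), by positivity, by rw [Real.sq_sqrt this.le]; ring⟩
  have hyz : y < z := by
    refine lt_of_pow_lt_pow_left₀ 2 hz.le ?_
    linarith
  have hd2 : x 7 ^ 2 = (z - y) ^ 2 := by
    have hS := congrFun hF 1
    rw [hx'] at hS
    simp only [dziobek, Matrix.cons_val, Pi.zero_apply] at hS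
    have hp2 : 8 * p ^ 2 ≠ 0 := by positivity
    rw [cayleyMenger_kite ha2 hb2 hc2] at hS
    have hS' := (mul_eq_zero.1 hS).resolve_left hp2
    have hfac : (2 * y * z - (y ^ 2 + z ^ 2 - x 7 ^ 2)) *
        (2 * y * z + (y ^ 2 + z ^ 2 - x 7 ^ 2)) = 0 := by linear_combination hS'
    -- `h27` says `x 7 ^ 2 < y ^ 2 + z ^ 2`; this excludes the root `y + z`, with the bodies 3 and 4
    -- on opposite sides of the base.
    have hpos : 0 < 2 * y * z + (y ^ 2 + z ^ 2 - x 7 ^ 2) := by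
      have : 0 < y * z := by positivity
      linarith
    linarith [(mul_eq_zero.1 hfac).resolve_right hpos.ne']
  have h4 : 0 < x 4 := h3.trans h34
  refine ⟨kite p y z, ?_, ?_, kite_third_mem_interior hp hy hyz⟩
  · rw [hx']
    exact kite_dist h2.le h3.le h4.le h7.le ha2 hb2 hc2 hd2
  · rw [hx'] at hF
    exact isCentralConfiguration_kite h2 h3 h4 h7 hm ha2 hb2 hc2 hd2 hF

end Kite

/-! ### Numerical data and kernel-checked certificates. -/

section Certificates

/-- Certificate for the inclusion of intervals. -/
def Ball.subset (a b : Ball) : Bool := Nat.ble ((a.c - b.c).natAbs + a.r) b.r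

theorem Ball.mem_of_subset {a b : Ball} (h : a.subset b = true) {x : ℝ} (hx : a.Mem x) :
    b.Mem x := by
  have h1 := (Nat.cast_le (α := ℝ)).2 (Nat.le_of_ble_eq_true h)
  push_cast at h1
  rw [Nat.cast_natAbs, Int.cast_abs] at h1
  push_cast at h1
  simp only [Mem] at *
  have := abs_sub_le (x * ballScale) a.c b.c
  linarith

theorem Ball.mem_iff_mem_Icc {b : Ball} {x : ℝ} :
    b.Mem x ↔ x ∈ Set.Icc ((b.c - b.r) / ballScale : ℝ) ((b.c + b.r) / ballScale) := by
  rw [Mem, abs_le, Set.mem_Icc, div_le_iff₀ ballScale_pos, le_div_iff₀ ballScale_pos]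
  constructor <;> rintro ⟨h1, h2⟩ <;> constructor <;> linarith

theorem Ball.mem_iff_mem_decimalInterval {b : Ball} {c : ℝ} {k : ℕ} (hc : (b.c : ℝ) = c * 10 ^ 40)
    (hr : (b.r : ℝ) = 10 ^ 40 / 10 ^ k) {x : ℝ} : b.Mem x ↔ x ∈ decimalInterval c k := by
  have hS : ((ballScale : ℕ) : ℝ) = 10 ^ 40 := by norm_num [ballScale]
  rw [mem_iff_mem_Icc, decimalInterval, hc, hr, hS]
  have h1 : (c * 10 ^ 40 - 10 ^ 40 / 10 ^ k) / 10 ^ 40 = c - 1 / 10 ^ k := by field_simp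
  have h2 : (c * 10 ^ 40 + 10 ^ 40 / 10 ^ k) / 10 ^ 40 = c + 1 / 10 ^ k := by field_simp
  rw [h1, h2]

/-- The box in which the singular zero is located; the null vector is known up to `r`. -/
def searchBox (r : ℕ) : Fin 17 → Ball :=
  ![⟨410486749931246396567394557 * 10 ^ 14, 10 ^ 14⟩, ⟨7904883951465367 * 10 ^ 24, 10 ^ 24⟩,
    ⟨98742601345654 * 10 ^ 26, 10 ^ 26⟩, ⟨57921860462471 * 10 ^ 26, 10 ^ 26⟩,
    ⟨100549177029900 * 10 ^ 26, 10 ^ 26⟩, ⟨57921860462471 * 10 ^ 26, 10 ^ 26⟩,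
    ⟨100549177029900 * 10 ^ 26, 10 ^ 26⟩, ⟨57304559793134 * 10 ^ 26, 10 ^ 26⟩,
    ⟨100266054757261000068580350 * 10 ^ 14, 10 ^ 14⟩, ⟨0, r⟩, ⟨-1790264478 * 10 ^ 30, r⟩,
    ⟨29895142148 * 10 ^ 30, r⟩, ⟨-5496816800 * 10 ^ 30, r⟩, ⟨-14331568125 * 10 ^ 30, r⟩,
    ⟨-5496816800 * 10 ^ 30, r⟩, ⟨-14331568125 * 10 ^ 30, r⟩, ⟨10 ^ 40, r⟩]

/-- Approximate solution `(x, m, v)`, in units of `10⁻³⁴`. -/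
def approxSolution : Fin 17 → ℤ :=
  ![41048674993124639656739455752552789, 7904883951465367924186251233040860, 9874260134565408605160239309132235, 5792186046247189428947637162880095, 10054917702990022812457778973449864, 5792186046247189428947637162880095, 10054917702990022812457778973449864, 5730455979313458580485304546084097, 10026605475726100006858035021861154, 0, -1790264478192246149789830174711189, 29895142147557452742684426181231704, -5496816800145101566366981268870829, -14331568125249437512893671899666954, -5496816800145101566366981268870829, -14331568125249437512893671899666954, 10000000000000000000000000000000000]

/-- The box with radius `r` around the approximate solution. -/
def solutionBox (r : ℕ) (i : Fin 17) : Ball := ⟨approxSolution i * 10 ^ 6, r⟩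

/-- Approximate left null vector, in units of `10⁻²²`. -/
def approxLeftNull : Fin 8 → ℤ :=
  ![0, -2353121308504796196433, 10068617794959297159991, -5380276783839489971739, -4654950135220327574696, -5380276783839489971739, -4654950135220327574696, 10000000000000000000000]

/-- The box with radius `r` around the approximate left null vector. -/
def leftNullBox (r : ℕ) (i : Fin 8) : Ball := ⟨approxLeftNull i * 10 ^ 18, r⟩

/-- `10⁵` times an approximate inverse of the derivative of `singularExpr`. -/
def singularInv : Fin 17 → Fin 17 → ℤ :=
  ![
    ![-153830, -267407, -26990, 42749, 30750, 42749, 30750, -17572, 0, 0, 0, 0, 0, 0, 0, 0, 0],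
    ![-69122, -14092, -21389, 18665, 7523, 18665, 7523, -11247, 0, -2, 9, -5, -4, -5, -4, 9, 0],
    ![12335, -14820, 5544, -1295, -1318, -1295, -1318, -311, 0, 34, -146, 78, 67, 78, 67, -145, 0],
    ![7235, 11880, 1957, -2349, 3780, 2304, -6068, 380, 0, -6, 27, -14, -12, -14, -12, 27, 0],
    ![12560, -3066, 1184, 13377, -12390, -16301, 10102, 4023, 0, -16, 70, -37, -32, -37, -32, 69, 0],
    ![7235, 11880, 1957, 2304, -6068, -2349, 3780, 380, 0, -6, 27, -14, -12, -14, -12, 27, 0],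
    ![12560, -3066, 1184, -16301, 10102, 13377, -12390, 4023, 0, -16, 70, -37, -32, -37, -32, 69, 0],
    ![7158, 8023, 572, -2325, 171, -2325, 171, 3725, 0, 11, -49, 26, 23, 26, 23, -48, 0],
    ![0, 3620, -15487, 8276, 7160, 8276, 7160, -15382, 0, 0, 0, 0, 0, 0, 0, 0, 0],
    ![0, 53708, 0, 0, 0, 0, 0, 0, -153830, -276671, 12651, 21566, 12423, 21566, 12423, 21799, 0],
    ![17891, -125113, 120470, -50582, -35777, -50582, -35777, 47838, -67840, -16732, -3847, 8929, -510, 8929, -510, 6741, -17903],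
    ![0, 105269, -39983, 31630, -15040, 31630, -15040, 6866, -9065, -39191, 5483, 4776, -2592, 4776, -2592, -9810, 298951],
    ![0, -36951, -2678, -579697, 557742, 576556, -544351, -7587, 11170, 16972, -647, -2067, 5224, 2585, -4624, -471, -54968],
    ![0, -6086, -2366, 1642317, -1557258, -1650575, 1579922, -12068, 22819, 9359, -1959, 12162, -10313, -17516, 12179, 5427, -143316],
    ![0, -36951, -2678, 576556, -544351, -579697, 557742, -7587, 11170, 16972, -647, 2585, -4624, -2067, 5224, -471, -54968],
    ![0, -6086, -2366, -1650575, 1579922, 1642317, -1557258, -12068, 22819, 9359, -1959, -17516, 12179, 12162, -10313, 5427, -143316],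
    ![0, 0, 0, 0, 0, 0, 0, 0, 0, 0, 0, 0, 0, 0, 0, 0, 100000]]

/-- `10⁵` times an approximate inverse of the bordered Jacobian matrix. -/
def kernelInv : Fin 8 → Fin 8 → ℤ :=
  ![
    ![-153830, -273714, 0, 28327, 18272, 28327, 18272, 9234],
    ![-67840, -17631, -17903, 6874, -2288, 6874, -2288, 10561],
    ![-9065, -37910, 298951, 7706, -57, 7706, -57, -15256],
    ![11170, 16821, -54968, -2413, 4925, 2239, -4924, 172],
    ![22819, 8901, -143316, 11115, -11219, -18563, 11274, 7372],
    ![11170, 16821, -54968, 2239, -4924, -2413, 4925, 172],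
    ![22819, 8901, -143316, -18563, 11274, 11115, -11219, 7372],
    ![0, 0, 100000, 0, 0, 0, 0, 0]]

/-- `10⁵` times an approximate inverse of the bordered transposed Jacobian matrix. -/
def leftKernelInv : Fin 8 → Fin 8 → ℤ :=
  ![
    ![-153830, -68383, 0, 9503, 18473, 9503, 18473, 3032],
    ![-271541, -17631, -23531, 9231, -9259, 9231, -9259, 13882],
    ![-9298, -9714, 100686, 2651, -59, 2651, -59, -5138],
    ![33295, 12526, -53803, -2413, 14841, 2239, -14837, 168],
    ![22571, 2200, -46550, 3688, -11219, -6160, 11274, 2395],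
    ![33295, 12526, -53803, 2239, -14837, -2413, 14841, 168],
    ![22571, 2200, -46550, -6160, 11274, 3688, -11219, 2395],
    ![0, 0, 100000, 0, 0, 0, 0, 0]]

/-- Interval version of the Jacobian matrix of the Dziobek map. -/
def ballJacobian (b : Fin 17 → Ball) (i j : Fin 8) : Ball :=
  ((dziobekExpr i).diff (j.castLE (by norm_num))).ballEval b

/-- Interval version of `Matrix.updateRow` with row `2` replaced by the last unit vector. -/
def ballBordered (T : Fin 8 → Fin 8 → Ball) (i j : Fin 8) : Ball :=
  bif Nat.beq i.val 2 then .ofInt (bif Nat.beq j.val 7 then 1 else 0) else T i j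

/-- Interval version of the product of a matrix without its row `2` and a vector. -/
def ballResidual (T : Fin 8 → Fin 8 → Ball) (c : Fin 8 → Ball) (i : Fin 8) : Ball :=
  bif Nat.beq i.val 2 then .ofInt 0 else Ball.dot (T i) c

/-- The null vector is allowed the radius `10⁻⁷`, which matches the enclosure obtained from
`kernel_residual_check`. -/
theorem singularInv_check : invCheck singularInv 100000
    (fun i k => ((singularExpr i).diff k).ballEval (searchBox (10 ^ 33))) = true := by
  decide +kernel

/-- The bound is `5 · 10⁻³¹`, half of the radius `10⁻³⁰` of the ball used for existence. -/
theorem singular_residual_check : mulVecCheck singularInv 100000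
    (fun i => (singularExpr i).ballEval (solutionBox 0)) (5 * 10 ^ 9) = true := by
  decide +kernel

theorem solutionBox_subset_check :
    ((List.finRange 17).all fun i =>
      (solutionBox (10 ^ 10) i).subset (searchBox (10 ^ 33) i)) = true := by
  decide +kernel

/-- The Jacobian does not involve `v`, so radius `0` for the null vector is enough. Row 2 may be
replaced since the left null vector does not vanish at that index. -/
theorem kernelInv_check :
    invCheck kernelInv 100000 (ballBordered (ballJacobian (searchBox 0))) = true := by
  decide +kernel

theorem kernel_residual_check : mulVecCheck kernelInv 100000
    (ballResidual (ballJacobian (searchBox 0)) fun j => searchBox 0 (j.natAdd 9))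
    (5 * 10 ^ 32) = true := by
  decide +kernel

theorem leftKernelInv_check : invCheck leftKernelInv 100000
    (ballBordered fun i j => ballJacobian (solutionBox (10 ^ 10)) j i) = true := by
  decide +kernel

/-- Doubling the bound `5 · 10⁻²¹`, as `norm_kernel_vector_sub_le` requires, gives the radius
`10⁻²⁰` of the box for `w`. -/
theorem leftKernel_residual_check : mulVecCheck leftKernelInv 100000
    (ballResidual (fun i j => ballJacobian (solutionBox (10 ^ 10)) j i) (leftNullBox 0))
    (5 * 10 ^ 19) = true := by
  decide +kernel

theorem mass_derivative_check :
    (Ball.dot (leftNullBox (10 ^ 20))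
      fun i => ((dziobekExpr i).diff 8).ballEval (solutionBox (10 ^ 10))).subset
        ⟨-6501134640 * 10 ^ 31, 10 ^ 31⟩ = true := by
  decide +kernel

theorem second_derivative_check :
    (Ball.dot (leftNullBox (10 ^ 20))
      fun i => (dirDeriv (dirDeriv (dziobekExpr i))).ballEval (solutionBox (10 ^ 10))).subset
        ⟨-206664414 * 10 ^ 35, 10 ^ 35⟩ = true := by
  decide +kernel

end Certificates

/-! ### From the certificates to the singular zero, its symmetry and its null vectors. -/

section Assembly

open Matrix

theorem Ball.mem_of_abs_sub_le {b : Ball} {c x : ℝ} {r : ℝ} (hc : c * ballScale = b.c)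
    (hr : r * ballScale ≤ b.r) (h : |x - c| ≤ r) : b.Mem x := by
  have hS := ballScale_pos
  rw [Mem, ← hc, ← sub_mul, abs_mul, abs_of_pos hS]
  exact (mul_le_mul_of_nonneg_right h hS.le).trans hr

theorem Ball.mem_decimalInterval {a : Ball} (C : ℤ) (R : ℕ) {c : ℝ} {k : ℕ} {x : ℝ} (hx : a.Mem x)
    (h : a.subset ⟨C, R⟩ = true) (hc : (C : ℝ) = c * 10 ^ 40) (hr : (R : ℝ) = 10 ^ 40 / 10 ^ k) :
    x ∈ decimalInterval c k :=
  (mem_iff_mem_decimalInterval (b := ⟨C, R⟩) hc hr).1 (mem_of_subset h hx)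

theorem forall_fin_joint {P : Fin 17 → Prop} : (∀ i, P i) ↔
    (∀ i : Fin 8, P (i.castLE (by norm_num))) ∧ P 8 ∧ ∀ j : Fin 8, P (j.natAdd 9) := by
  refine ⟨fun h => ⟨fun i => h _, h _, fun j => h _⟩, fun ⟨h1, h2, h3⟩ i => ?_⟩
  rcases lt_trichotomy i.val 8 with h | h | h
  · exact h1 ⟨i.val, h⟩
  · have : i = 8 := Fin.ext h
    exact this ▸ h2
  · convert h3 ⟨i.val - 9, by omega⟩
    ext
    simp
    omega

@[simp] theorem joint_castLE (x : Fin 8 → ℝ) (m : ℝ) (v : Fin 8 → ℝ) (i : Fin 8) :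
    joint x m v (i.castLE (by norm_num)) = x i := by
  fin_cases i <;> rfl

@[simp] theorem joint_mass (x : Fin 8 → ℝ) (m : ℝ) (v : Fin 8 → ℝ) : joint x m v 8 = m := rfl

@[simp] theorem joint_natAdd (x : Fin 8 → ℝ) (m : ℝ) (v : Fin 8 → ℝ) (j : Fin 8) :
    joint x m v (j.natAdd 9) = v j := by
  fin_cases j <;> rfl

theorem joint_injective {x x' : Fin 8 → ℝ} {m m' : ℝ} {v v' : Fin 8 → ℝ}
    (h : joint x m v = joint x' m' v') : x = x' ∧ m = m' ∧ v = v' := by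
  refine ⟨funext fun i => ?_, congrFun h 8, funext fun i => ?_⟩
  · simpa using congrFun h (i.castLE (by norm_num))
  · simpa using congrFun h (i.natAdd 9)

theorem exists_joint_eq (z : Fin 17 → ℝ) : ∃ x m v, joint x m v = z :=
  ⟨fun i => z (i.castLE (by norm_num)), z 8, fun i => z (i.natAdd 9),
    funext (forall_fin_joint.2 ⟨by simp, by simp, by simp⟩)⟩

/-- The centre of the search box for the right null vector. -/
def approxNull (j : Fin 8) : ℝ := (searchBox 0 (j.natAdd 9)).c / ballScale

/-- The first nine intervals are exactly those of `xBox` and `mBox`, so uniqueness in the search box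
is uniqueness in the stated box once `v` is enclosed. -/
theorem searchBox_mem_joint_iff {r : ℕ} {x : Fin 8 → ℝ} {m : ℝ} {v : Fin 8 → ℝ} :
    (∀ i, (searchBox r i).Mem (joint x m v i)) ↔
      x ∈ xBox ∧ m ∈ mBox ∧ ∀ j : Fin 8, (searchBox r (j.natAdd 9)).Mem (v j) := by
  have key : ∀ (C : ℤ) (R : ℕ) (c : ℝ) (k : ℕ) (t : ℝ), (C : ℝ) = c * 10 ^ 40 →
      (R : ℝ) = 10 ^ 40 / 10 ^ k → ((Ball.mk C R).Mem t ↔ t ∈ decimalInterval c k) :=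
    fun C R c k t hc hr => Ball.mem_iff_mem_decimalInterval (b := ⟨C, R⟩) hc hr
  have h0 := key (410486749931246396567394557 * 10 ^ 14) (10 ^ 14) 4.10486749931246396567394557 26
    (x 0) (by norm_num) (by norm_num)
  have h1 := key (7904883951465367 * 10 ^ 24) (10 ^ 24) 0.7904883951465367 16
    (x 1) (by norm_num) (by norm_num)
  have h2 := key (98742601345654 * 10 ^ 26) (10 ^ 26) 0.98742601345654 14
    (x 2) (by norm_num) (by norm_num)
  have h3 := fun t => key (57921860462471 * 10 ^ 26) (10 ^ 26) 0.57921860462471 14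
    t (by norm_num) (by norm_num)
  have h4 := fun t => key (100549177029900 * 10 ^ 26) (10 ^ 26) 1.00549177029900 14
    t (by norm_num) (by norm_num)
  have h7 := key (57304559793134 * 10 ^ 26) (10 ^ 26) 0.57304559793134 14
    (x 7) (by norm_num) (by norm_num)
  have h8 := key (100266054757261000068580350 * 10 ^ 14) (10 ^ 14) 1.00266054757261000068580350 26
    m (by norm_num) (by norm_num)
  have hxm : (∀ i : Fin 8, (searchBox r (i.castLE (by norm_num))).Mem (x i)) ↔ x ∈ xBox := by
    change _ ↔ _ ∧ _ ∧ _ ∧ _ ∧ _ ∧ _ ∧ _ ∧ _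
    rw [← h0, ← h1, ← h2, ← h3, ← h4, ← h3, ← h4, ← h7]
    exact ⟨fun h => ⟨h 0, h 1, h 2, h 3, h 4, h 5, h 6, h 7⟩,
      fun ⟨g0, g1, g2, g3, g4, g5, g6, g7⟩ i => by fin_cases i <;> assumption⟩
  rw [forall_fin_joint, ← hxm]
  simp only [joint_castLE, joint_mass, joint_natAdd]
  exact and_congr_right fun _ => and_congr_left fun _ => h8

theorem isApproxInv_singular {z : Fin 17 → ℝ} (hz : ∀ i, (searchBox (10 ^ 33) i).Mem (z i)) :
    IsApproxInv (scaledMatrix singularInv 100000)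
      (Matrix.of fun i j => ((singularExpr i).diff j).eval z) :=
  isApproxInv_of_invCheck (by norm_num) singularInv_check fun i j =>
    PolyExpr.mem_ballEval hz ((singularExpr i).diff j)

theorem singular_zero_unique {z z' : Fin 17 → ℝ} (hz : ∀ i, (searchBox (10 ^ 33) i).Mem (z i))
    (hz' : ∀ i, (searchBox (10 ^ 33) i).Mem (z' i)) (h : (fun i => (singularExpr i).eval z) = 0)
    (h' : (fun i => (singularExpr i).eval z') = 0) : z = z' := by
  refine zero_unique_of_newton (s := {z | ∀ i, (searchBox (10 ^ 33) i).Mem (z i)})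
    (hasFDerivAt_eval_pi singularExpr) ?_ (fun y hy => isApproxInv_singular hy) hz hz' h h'
  have : {z : Fin 17 → ℝ | ∀ i, (searchBox (10 ^ 33) i).Mem (z i)} =
      Set.univ.pi fun i => {t | (searchBox (10 ^ 33) i).Mem t} := by
    ext z
    simp
  rw [this]
  refine convex_pi fun i _ => ?_
  simp only [Ball.mem_iff_mem_Icc]
  exact convex_Icc _ _

theorem searchBox_mem_of_solutionBox_mem {z : Fin 17 → ℝ}
    (hz : ∀ i, (solutionBox (10 ^ 10) i).Mem (z i)) (i : Fin 17) :
    (searchBox (10 ^ 33) i).Mem (z i) :=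
  Ball.mem_of_subset (List.all_eq_true.1 solutionBox_subset_check i (List.mem_finRange i)) (hz i)

/-- Existence is proved in a ball of radius `10⁻³⁰`, much smaller than the search box; its precision
feeds the later enclosures. -/
theorem exists_singular_zero : ∃ z : Fin 17 → ℝ, (∀ i, (solutionBox (10 ^ 10) i).Mem (z i)) ∧
    (fun i => (singularExpr i).eval z) = 0 := by
  have hS : ((ballScale : ℕ) : ℝ) = 10 ^ 40 := by norm_num [ballScale]
  let c : Fin 17 → ℝ := fun i => (solutionBox 0 i).c / ballScale
  have hc : ∀ i, c i * ballScale = (solutionBox 0 i).c := fun i =>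
    div_mul_cancel₀ _ Ball.ballScale_pos.ne'
  have hmem : ∀ z ∈ Metric.closedBall c (1 / 10 ^ 30), ∀ i, (solutionBox (10 ^ 10) i).Mem (z i) := by
    intro z hz i
    refine Ball.mem_of_abs_sub_le (hc i) ?_
      ((norm_le_pi_norm (z - c) i).trans (mem_closedBall_iff_norm.1 hz))
    rw [hS]
    norm_num [solutionBox]
  obtain ⟨z, hz, h0⟩ := exists_zero_of_newton (hasFDerivAt_eval_pi singularExpr)
    (c := c) (ρ := 1 / 10 ^ 30) (A := scaledMatrix singularInv 100000) (by positivity)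
    (fun z hz => isApproxInv_singular (searchBox_mem_of_solutionBox_mem (hmem z hz)))
    ((norm_mulVec_le_of_mulVecCheck (by norm_num) singular_residual_check fun j =>
      PolyExpr.mem_ballEval (fun i => Ball.mem_of_abs_sub_le (r := 0) (hc i) (by simp [solutionBox])
        (by simp)) _).trans (by rw [hS]; norm_num))
  exact ⟨z, hmem z hz, h0⟩

theorem ballBordered_mem {T : Fin 8 → Fin 8 → Ball} {J : Matrix (Fin 8) (Fin 8) ℝ}
    (h : ∀ i j, (T i j).Mem (J i j)) (i j : Fin 8) :
    (ballBordered T i j).Mem (J.updateRow 2 (Pi.single 7 1) i j) := by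
  unfold ballBordered
  by_cases hi : i = 2
  · subst hi
    by_cases hj : j = 7
    · subst hj
      simpa using Ball.mem_ofInt 1
    · have : Nat.beq j.val 7 = false := beq_val_eq_false hj
      simpa [this, hj] using Ball.mem_ofInt 0
  · have : Nat.beq i.val 2 = false := beq_val_eq_false hi
    simpa [this, hi, Matrix.updateRow_ne] using h i j

theorem ballResidual_mem {T : Fin 8 → Fin 8 → Ball} {J : Matrix (Fin 8) (Fin 8) ℝ}
    {b : Fin 8 → Ball} {c : Fin 8 → ℝ} (h : ∀ i j, (T i j).Mem (J i j))
    (hc : ∀ i, (b i).Mem (c i)) (i : Fin 8) :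
    (ballResidual T b i).Mem ((J.updateRow 2 0 *ᵥ c) i) := by
  unfold ballResidual
  by_cases hi : i = 2
  · subst hi
    simpa [Matrix.mulVec] using Ball.mem_ofInt 0
  · have : Nat.beq i.val 2 = false := beq_val_eq_false hi
    simpa [this, hi, Matrix.mulVec, Matrix.updateRow_ne] using Ball.mem_dot (h i) hc

theorem ballJacobian_mem {b : Fin 17 → Ball} {x : Fin 8 → ℝ} {m : ℝ} {v : Fin 8 → ℝ}
    (h : ∀ i, (b i).Mem (joint x m v i)) (i j : Fin 8) :
    (ballJacobian b i j).Mem (jacobian dziobek x m i j) := by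
  rw [jacobian_dziobek_apply x m v]
  exact PolyExpr.mem_ballEval h _

theorem searchBox_mem_approxNull (j : Fin 8) : (searchBox 0 (j.natAdd 9)).Mem (approxNull j) := by
  rw [Ball.Mem, approxNull, div_mul_cancel₀ _ Ball.ballScale_pos.ne']
  simp

theorem isApproxInv_kernel {x : Fin 8 → ℝ} {m : ℝ} (hx : x ∈ xBox) (hm : m ∈ mBox) :
    IsApproxInv (scaledMatrix kernelInv 100000)
      ((jacobian dziobek x m).updateRow 2 (Pi.single 7 1)) :=
  isApproxInv_of_invCheck (by norm_num) kernelInv_check (ballBordered_mem (ballJacobian_mem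
    (searchBox_mem_joint_iff.2 ⟨hx, hm, searchBox_mem_approxNull⟩)))

/-- No equation `F = 0` is needed: the bordered matrix confines normalized null vectors uniformly
over the box. -/
theorem searchBox_mem_kernel_vector {x : Fin 8 → ℝ} {m : ℝ} {v : Fin 8 → ℝ} (hx : x ∈ xBox)
    (hm : m ∈ mBox) (hv : jacobian dziobek x m *ᵥ v = 0) (hv7 : v 7 = 1) (j : Fin 8) :
    (searchBox (10 ^ 33) (j.natAdd 9)).Mem (v j) := by
  have hS : ((ballScale : ℕ) : ℝ) = 10 ^ 40 := by norm_num [ballScale]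
  have hr : (searchBox (10 ^ 33) (j.natAdd 9)).r = 10 ^ 33 := by
    revert j
    decide +kernel
  have hc : (searchBox 0 (j.natAdd 9)).c = (searchBox (10 ^ 33) (j.natAdd 9)).c := by
    revert j
    decide +kernel
  have h7 : approxNull 7 = 1 := by
    rw [approxNull, div_eq_one_iff_eq Ball.ballScale_pos.ne', hS]
    change (((10 ^ 40 : ℤ)) : ℝ) = _
    norm_num
  have h1 := norm_kernel_vector_sub_le (isApproxInv_kernel hx hm) hv hv7 h7
  have h2 := norm_mulVec_le_of_mulVecCheck (by norm_num) kernel_residual_check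
    (ballResidual_mem (ballJacobian_mem (searchBox_mem_joint_iff.2
      ⟨hx, hm, searchBox_mem_approxNull⟩)) searchBox_mem_approxNull)
  have h3 := (norm_le_pi_norm (v - approxNull) j).trans (h1.trans (mul_le_mul_of_nonneg_left h2 two_pos.le))
  refine Ball.mem_of_abs_sub_le (c := approxNull j) ?_ ?_ h3
  · rw [approxNull, div_mul_cancel₀ _ Ball.ballScale_pos.ne', hc]
  · rw [hr, hS]
    norm_num

/-- The singular zero of the Dziobek map in the search box is unique. -/
theorem dziobek_singular_unique {x y v : Fin 8 → ℝ} {m m' : ℝ} (hx : x ∈ xBox) (hm : m ∈ mBox)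
    (hF : dziobek x m = 0) (hv : jacobian dziobek x m *ᵥ v = 0) (hv7 : v 7 = 1) (hy : y ∈ xBox)
    (hm' : m' ∈ mBox) (hF' : dziobek y m' = 0) (hdet : (jacobian dziobek y m').det = 0) :
    y = x ∧ m' = m := by
  obtain ⟨u, hu, hu7, -⟩ := exists_kernel_vector hdet (isApproxInv_kernel hy hm')
  obtain ⟨h1, h2, -⟩ := joint_injective (singular_zero_unique
    (searchBox_mem_joint_iff.2 ⟨hy, hm', searchBox_mem_kernel_vector hy hm' hu hu7⟩)
    (searchBox_mem_joint_iff.2 ⟨hx, hm, searchBox_mem_kernel_vector hx hm hv hv7⟩)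
    ((eval_singularExpr_joint_eq_zero_iff y m' u).2 ⟨hF', hu, hu7⟩)
    ((eval_singularExpr_joint_eq_zero_iff x m v).2 ⟨hF, hv, hv7⟩))
  exact ⟨h1, h2⟩

theorem swap12_mem_xBox {x : Fin 8 → ℝ} (hx : x ∈ xBox) : swap12 x ∈ xBox := by
  obtain ⟨h0, h1, h2, h3, h4, h5, h6, h7⟩ := hx
  exact ⟨h0, h1, h2, h5, h6, h3, h4, h7⟩

theorem dziobek_swap12 (x : Fin 8 → ℝ) (m : ℝ) :
    dziobek (swap12 x) m = swap12 (dziobek x m) := by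
  funext i
  fin_cases i <;>
    simp only [Fin.mk_zero, Fin.mk_one, Fin.reduceFinMk, dziobek, swap12, weightedSquares,
      cayleyMenger_eq, sPartial, Matrix.cons_val] <;> ring

/-- Both sides come from differentiating the equivariance `dziobek_swap12` by the chain rule. -/
theorem jacobian_swap12_mulVec (x v : Fin 8 → ℝ) (m : ℝ) :
    jacobian dziobek (swap12 x) m *ᵥ swap12 v = swap12 (jacobian dziobek x m *ᵥ v) := by
  let L₀ : (Fin 8 → ℝ) →ₗ[ℝ] (Fin 8 → ℝ) :=
    { toFun := swap12
      map_add' := fun a b => by simp [swap12]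
      map_smul' := fun a b => by simp [swap12] }
  let L := L₀.toContinuousLinearMap
  have hd : Differentiable ℝ (fun y => dziobek y m) := fun y =>
    (hasFDerivAt_dziobek y m 0).differentiableAt
  have h1 : HasFDerivAt (fun y => dziobek (swap12 y) m) _ x :=
    HasFDerivAt.comp (g := fun y => dziobek y m) (f := L) x (hd _).hasFDerivAt L.hasFDerivAt
  have h2 : HasFDerivAt (fun y => swap12 (dziobek y m)) _ x :=
    L.hasFDerivAt.comp x (hd x).hasFDerivAt
  simp only [dziobek_swap12] at h1
  rw [jacobian_mulVec, jacobian_mulVec]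
  exact congrArg (fun T => T v) (h1.unique h2)

/-- The reflected point is again a singular zero in the box, with null vector `swap12 v`, so
uniqueness identifies it with `x`. -/
theorem swap12_eq_of_singular {x v : Fin 8 → ℝ} {m : ℝ} (hx : x ∈ xBox) (hm : m ∈ mBox)
    (hF : dziobek x m = 0) (hv : jacobian dziobek x m *ᵥ v = 0) (hv7 : v 7 = 1) :
    swap12 x = x := by
  have h0 : swap12 0 = 0 := by
    funext i
    fin_cases i <;> rfl
  refine (dziobek_singular_unique hx hm hF hv hv7 (swap12_mem_xBox hx) hm
    (by rw [dziobek_swap12, hF, h0]) ?_).1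
  refine Matrix.exists_mulVec_eq_zero_iff.1 ⟨swap12 v, fun h => ?_, ?_⟩
  · have := congrFun h 7
    simp [swap12, hv7] at this
  · rw [jacobian_swap12_mulVec, hv, h0]

theorem xBox_bounds {x : Fin 8 → ℝ} (hx : x ∈ xBox) :
    0.98 < x 2 ∧ x 2 < 0.99 ∧ 0.57 < x 3 ∧ x 3 < 0.58 ∧ 1 < x 4 ∧ 0.57 < x 7 ∧ x 7 < 0.58 := by
  obtain ⟨-, -, h2, h3, h4, -, -, h7⟩ := hx
  simp only [decimalInterval, Set.mem_Icc] at h2 h3 h4 h7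
  norm_num at h2 h3 h4 h7 ⊢
  refine ⟨?_, ?_, ?_, ?_, ?_, ?_, ?_⟩ <;> linarith

theorem exists_left_null_vector {x v : Fin 8 → ℝ} {m : ℝ}
    (hz : ∀ i, (solutionBox (10 ^ 10) i).Mem (joint x m v i))
    (hdet : (jacobian dziobek x m).det = 0) :
    ∃ w : Fin 8 → ℝ, (jacobian dziobek x m)ᵀ *ᵥ w = 0 ∧ w 7 = 1 ∧
      ∀ i, (leftNullBox (10 ^ 20) i).Mem (w i) := by
  have hS : ((ballScale : ℕ) : ℝ) = 10 ^ 40 := by norm_num [ballScale]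
  have hJ : ∀ i j, (ballJacobian (solutionBox (10 ^ 10)) j i).Mem ((jacobian dziobek x m)ᵀ i j) :=
    fun i j => ballJacobian_mem hz j i
  have hB : IsApproxInv (scaledMatrix leftKernelInv 100000)
      ((jacobian dziobek x m)ᵀ.updateRow 2 (Pi.single 7 1)) :=
    isApproxInv_of_invCheck (by norm_num) leftKernelInv_check (ballBordered_mem hJ)
  obtain ⟨w, hw, hw7, -⟩ := exists_kernel_vector (by rw [Matrix.det_transpose, hdet]) hB
  refine ⟨w, hw, hw7, fun i => ?_⟩
  let c : Fin 8 → ℝ := fun i => (leftNullBox 0 i).c / ballScale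
  have hc : ∀ i, c i * ballScale = (leftNullBox 0 i).c := fun i =>
    div_mul_cancel₀ _ Ball.ballScale_pos.ne'
  have hc7 : c 7 = 1 := by
    rw [div_eq_one_iff_eq Ball.ballScale_pos.ne', hS]
    simp [leftNullBox, approxLeftNull]
    norm_num
  have h1 := norm_kernel_vector_sub_le hB hw hw7 hc7
  have h2 := norm_mulVec_le_of_mulVecCheck (by norm_num) leftKernel_residual_check
    (ballResidual_mem hJ (c := c) fun i =>
      Ball.mem_of_abs_sub_le (r := 0) (hc i) (by simp [leftNullBox]) (by simp))
  refine Ball.mem_of_abs_sub_le (hc i) ?_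
    ((norm_le_pi_norm (w - c) i).trans (h1.trans (mul_le_mul_of_nonneg_left h2 two_pos.le)))
  rw [hS]
  norm_num [leftNullBox]

theorem mem_vBox_of_solutionBox_mem {x v : Fin 8 → ℝ} {m : ℝ}
    (hz : ∀ i, (solutionBox (10 ^ 10) i).Mem (joint x m v i)) (hv7 : v 7 = 1) : v ∈ vBox := by
  refine ⟨Ball.mem_decimalInterval 0 (10 ^ 31) (hz 9) (by decide +kernel) ?_ ?_,
    Ball.mem_decimalInterval (-179026448 * 10 ^ 31) (10 ^ 31) (hz 10) (by decide +kernel) ?_ ?_,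
    Ball.mem_decimalInterval (2989514215 * 10 ^ 31) (10 ^ 31) (hz 11) (by decide +kernel) ?_ ?_,
    Ball.mem_decimalInterval (-5496816801 * 10 ^ 30) (10 ^ 30) (hz 12) (by decide +kernel) ?_ ?_,
    Ball.mem_decimalInterval (-14331568126 * 10 ^ 30) (10 ^ 30) (hz 13) (by decide +kernel) ?_ ?_,
    Ball.mem_decimalInterval (-5496816801 * 10 ^ 30) (10 ^ 30) (hz 14) (by decide +kernel) ?_ ?_,
    Ball.mem_decimalInterval (-14331568126 * 10 ^ 30) (10 ^ 30) (hz 15) (by decide +kernel) ?_ ?_,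
    hv7⟩ <;> norm_num

theorem mem_wBox_of_leftNullBox_mem {w : Fin 8 → ℝ} (hw : ∀ i, (leftNullBox (10 ^ 20) i).Mem (w i))
    (hw7 : w 7 = 1) : w ∈ wBox := by
  refine ⟨Ball.mem_decimalInterval 0 (10 ^ 31) (hw 0) (by decide +kernel) ?_ ?_,
    Ball.mem_decimalInterval (-235312131 * 10 ^ 31) (10 ^ 31) (hw 1) (by decide +kernel) ?_ ?_,
    Ball.mem_decimalInterval (10068617795 * 10 ^ 30) (10 ^ 30) (hw 2) (by decide +kernel) ?_ ?_,
    Ball.mem_decimalInterval (-5380276784 * 10 ^ 30) (10 ^ 30) (hw 3) (by decide +kernel) ?_ ?_,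
    Ball.mem_decimalInterval (-46549501352 * 10 ^ 29) (10 ^ 29) (hw 4) (by decide +kernel) ?_ ?_,
    Ball.mem_decimalInterval (-5380276784 * 10 ^ 30) (10 ^ 30) (hw 5) (by decide +kernel) ?_ ?_,
    Ball.mem_decimalInterval (-46549501352 * 10 ^ 29) (10 ^ 29) (hw 6) (by decide +kernel) ?_ ?_,
    hw7⟩ <;> norm_num

theorem dotProduct_mass_derivative_mem {x v w : Fin 8 → ℝ} {m : ℝ}
    (hz : ∀ i, (solutionBox (10 ^ 10) i).Mem (joint x m v i))
    (hw : ∀ i, (leftNullBox (10 ^ 20) i).Mem (w i)) :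
    w ⬝ᵥ deriv (fun t => dziobek x t) m ∈ decimalInterval (-6.501134640) 9 := by
  refine Ball.mem_decimalInterval _ _ (Ball.mem_dot hw fun i => ?_) mass_derivative_check
    (by norm_num) (by norm_num)
  rw [deriv_dziobek_mass_apply x m v]
  exact PolyExpr.mem_ballEval hz _

theorem dotProduct_second_derivative_mem {x v w : Fin 8 → ℝ} {m : ℝ}
    (hz : ∀ i, (solutionBox (10 ^ 10) i).Mem (joint x m v i))
    (hw : ∀ i, (leftNullBox (10 ^ 20) i).Mem (w i)) :
    w ⬝ᵥ fderiv ℝ (fderiv ℝ (fun y => dziobek y m)) x v v ∈ decimalInterval (-2066.64414) 5 := by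
  refine Ball.mem_decimalInterval _ _ (Ball.mem_dot hw fun i => ?_) second_derivative_check
    (by norm_num) (by norm_num)
  rw [fderiv_fderiv_dziobek_apply x m v]
  exact PolyExpr.mem_ballEval hz _

theorem neg_of_mem_decimalInterval {c t : ℝ} {k : ℕ} (hc : c < -1)
    (h : t ∈ decimalInterval c k) : t < 0 := by
  have h1 : (1 : ℝ) / 10 ^ k ≤ 1 := by
    rw [div_le_one (by positivity)]
    exact one_le_pow₀ (by norm_num)
  have := h.2
  linarith

end Assembly

end FourBody

end

open FourBody
theorem mainTheorem2 :
    ∃ x : Fin 8 → ℝ, ∃ m : ℝ,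
      -- existence and uniqueness of the singular solution in the box
      (x ∈ xBox ∧ m ∈ mBox ∧ dziobek x m = 0 ∧ (jacobian dziobek x m).det = 0) ∧
      (∀ y : Fin 8 → ℝ, ∀ m' : ℝ, y ∈ xBox → m' ∈ mBox → dziobek y m' = 0 →
        (jacobian dziobek y m').det = 0 → y = x ∧ m' = m) ∧
      -- it is a symmetric central configuration with the third body inside the triangle
      swap12 x = x ∧
      (∃ q : Fin 4 → EuclideanSpace ℝ (Fin 2),
        HasMutualDistances q x ∧ IsCentralConfiguration (mass m) q ∧
        q 2 ∈ interior (convexHull ℝ {q 0, q 1, q 3})) ∧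
      -- the kernel is one-dimensional, and the transversality conditions hold
      Module.finrank ℝ (LinearMap.ker (jacobian dziobek x m).mulVecLin) = 1 ∧
      (∃ v ∈ vBox, ∃ w ∈ wBox,
        (jacobian dziobek x m).mulVec v = 0 ∧ (jacobian dziobek x m).transpose.mulVec w = 0 ∧
        w ⬝ᵥ deriv (fun t => dziobek x t) m ≠ 0 ∧
        w ⬝ᵥ fderiv ℝ (fderiv ℝ (fun y => dziobek y m)) x v v ≠ 0 ∧
        w ⬝ᵥ deriv (fun t => dziobek x t) m ∈ decimalInterval (-6.501134640) 9 ∧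
        w ⬝ᵥ fderiv ℝ (fderiv ℝ (fun y => dziobek y m)) x v v ∈
          decimalInterval (-2066.64414) 5) ∧
      -- the fold: two solutions for masses below `m`, none for masses above `m`
      IsFoldBifurcation dziobek x m (-1) := by
  obtain ⟨z, hz, hz0⟩ := exists_singular_zero
  obtain ⟨x, m, v, rfl⟩ := exists_joint_eq z
  obtain ⟨hF, hv, hv7⟩ := (eval_singularExpr_joint_eq_zero_iff x m v).1 hz0
  obtain ⟨hx, hm, -⟩ := searchBox_mem_joint_iff.1 (searchBox_mem_of_solutionBox_mem hz)
  have hv0 : v ≠ 0 := by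
    rintro rfl
    simp at hv7
  have hdet : (jacobian dziobek x m).det = 0 := Matrix.exists_mulVec_eq_zero_iff.1 ⟨v, hv0, hv⟩
  have hker : ∀ u, (jacobian dziobek x m).mulVec u = 0 → u = u 7 • v := by
    -- The normalization `v 7 = 1` identifies the abstract kernel generator with the `v` found by
    -- Newton's method.
    obtain ⟨v', -, -, h'⟩ := exists_kernel_vector hdet (isApproxInv_kernel hx hm)
    have hvv : v = v' := by
      have := h' v hv
      rwa [hv7, one_smul] at this
    rwa [← hvv] at h'
  obtain ⟨w, hw, hw7, hwb⟩ := exists_left_null_vector hz hdet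
  have hFm := dotProduct_mass_derivative_mem hz hwb
  have hFvv := dotProduct_second_derivative_mem hz hwb
  have hFm0 := neg_of_mem_decimalInterval (by norm_num) hFm
  have hFvv0 := neg_of_mem_decimalInterval (by norm_num) hFvv
  have hsym := swap12_eq_of_singular hx hm hF hv hv7
  refine ⟨x, m, ⟨hx, hm, hF, hdet⟩, fun y m' hy hm' hF' hdet' =>
    dziobek_singular_unique hx hm hF hv hv7 hy hm' hF' hdet', hsym, ?_, ?_,
    ⟨v, mem_vBox_of_solutionBox_mem hz hv7, w, mem_wBox_of_leftNullBox_mem hwb hw7, hv, hw,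
      hFm0.ne, hFvv0.ne, hFm, hFvv⟩, ?_⟩
  · obtain ⟨h2, h2', h3, h3', h4, h7, h7'⟩ := xBox_bounds hx
    have hm0 : 0 < m := by
      have := hm.1
      norm_num at this
      linarith
    refine exists_central_kite hsym hF hm0 ?_ ?_ ?_ ?_ ?_ ?_ <;> nlinarith
  · refine finrank_eq_one_iff'.2 ⟨⟨v, hv⟩, fun h => hv0 (congrArg Subtype.val h), ?_⟩
    rintro ⟨u, hu⟩
    exact ⟨u 7, Subtype.ext (hker u hu).symm⟩
  · let φ : (Fin 8 → ℝ) →L[ℝ] ℝ :=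
      ∑ i, w i • ContinuousLinearMap.proj (R := ℝ) (φ := fun _ => ℝ) i
    have hφ : ∀ u, φ u = w ⬝ᵥ u := fun u => by simp [φ, dotProduct]
    refine isFoldBifurcation_of_simple_kernel (v := v) (φ := φ)
      (ℓ := ContinuousLinearMap.proj (R := ℝ) (φ := fun _ => ℝ) 7) contDiff_dziobek hF hv7
      (fun u hu => hker u (by rw [jacobian_mulVec, hu])) (fun u => ?_) (by rw [hφ]; exact hFm0.ne) ?_
    -- Pairing with `w` kills the range of the Jacobian because `w` lies in the kernel of the
    -- transpose.
    · rw [hφ, ← jacobian_mulVec, Matrix.dotProduct_mulVec, ← Matrix.mulVec_transpose, hw,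
        zero_dotProduct]
    · rw [hφ, hφ]
      -- Both pairings are negative, so `μ''` is negative and `σ = -1` is the right side.
      have := div_neg_of_pos_of_neg (neg_pos.2 hFvv0) hFm0
      linarith
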